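/- Let $d\ge 1$. A (generalized) linear diagram with $n$ cliques is a partition of $dn$ points $1,2,\dots,dn$ on a line into $n$ blocks ("cliques $K_d$") of $d$ points each; a loop is a pair of neighbouring points $i,i+1$ lying in the same clique. Let $a_{n,k}=a_{n,k}^{(d)}$ be the number of linear diagrams with $n$ cliques and exactly $k$ loops (so $a_{0,0}=1$; put $a_{n,k}=0$ if $n<0$ or $k<0$), and let $a_{n,k,l}$ be the number of those in which exactly $l$ cliques contain a loop. Binomial coefficients with a negative lower argument are $0$. Put $$c_{n,k,t}=\sum_{i=0}^{d-1}\binom{d-1}{i}\binom{t}{t+i-k}\binom{d(n-1)-t}{d-2i-t+k-1}.$$ (i) (One clique.) For all $n\ge 0$ and $1\le k\le d-1$, $$a_{n,k,1}=\binom{d-1}{k}\sum_{m=0}^{d-k}\binom{d(n-1)+1-m}{d-k-m}\,a_{n-1,m}.$$ (ii) (Several cliques.) For all $n\ge 0$, $1\le k\le d-1$ and $1<l\le k$, $$a_{n,k,l}=\sum_{R}\frac{\alpha_R}{\beta_1!\cdots\beta_{d-1}!}\sum_{m=0}^{ld-k}p_{n,R,m}\,a_{n-l,m},$$ where $R$ runs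 over the multisets $1\le r_1\le r_2\le\dots\le r_l\le d-1$ with $\sum_{i=1}^l(d-r_i)=k$, $\beta_u$ is the multiplicity of $u$ in $R$, $\alpha_R=\prod_{i=1}^l\binom{d-1}{r_i-1}$, and $$p_{n,R,m}=\sum_{j_1=0}^{r_1-1}\ \sum_{s_1=0}^{\min\{m_1,r_1-j_1\}}\cdots\sum_{j_{l-1}=0}^{r_{l-1}-1}\ \sum_{s_{l-1}=0}^{\min\{m_{l-1},r_{l-1}-j_{l-1}\}}\left[\prod_{i=1}^{l-1}\binom{m_i}{s_i}\binom{v_i-m_i}{r_i-j_i-s_i}\binom{r_i-1}{j_i}\right]\binom{v_l-m_l}{r_l-m_l}$$ with $m_1=m$, $v_1=d(n-l)+1$, and $m_{i+1}=m_i+j_i-s_i$, $v_{i+1}=v_i+r_i$ for $1\le i\le l-1$. (iii) For all $n\ge 0$ and $1\le k\le d-1$, $a_{n,k}=\sum_{l=1}^{k}a_{n,k,l}$. (iv) For all $n\ge 1$ and $k\ge 0$, $$a_{n,k}=\sum_{t=k-d+1}^{k+d-1}c_{n,k,t}\,a_{n-1,t},\qquad\text{in particular}\qquad a_{n,0}=\sum_{t=0}^{d-1}c_{n,0,t}\,a_{n-1,t};$$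 moreover $c_{n,k,k+d-1}\ne 0$, so that $$a_{n-1,k+d-1}=\frac{a_{n,k}-\sum_{t=k-d+1}^{k+d-2}c_{n,k,t}\,a_{n-1,t}}{c_{n,k,k+d-1}}.\qquad(*)$$ (v) (Closed system.) Repeated use of $(*)$ (together with $a_{n,m}=0$ for $n<0$, and for $m\ge 1$ if $d=1$) expresses every $a_{n,m}$ with $m\ge d$ through numbers $a_{n',t}$ with $0\le t\le d-1$. For $1\le k\le d-1$, $1<l\le k$ and $0\le m\le ld-k$, the resulting expression of $a_{n-l,m}$ involves only the numbers $a_{n-i,t}$ with $1\le i\le l$, $0\le t\le d-1$. Replacing in (ii) every $a_{n-l,m}$ with $m\ge d$ by this expression, the equation for $a_{n,0}$ in (iv) and the equations for $a_{n,k}$, $1\le k\le d-1$, obtained from (i)-(iii), for $n\ge1$, form a closed system of recurrences in the sequences $a_{n,0},\dots,a_{n,d-1}$: these sequences satisfy it, and they are its only rational-valued solution with the initial conditions $a_{0,0}=1$, $a_{0,k}=0$ for $1\le k\le d-1$, and $a_{n,k}=0$ for $n<0$. -/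

import Mathlib

open scoped BigOperators

noncomputable section

namespace LinearDiagram

/-- The loops formed by a set `B` of points on a line: the pairs `{i, i + 1}` of neighbouring points
that both lie in `B`. Each such pair is recorded by its left end `i`. -/
def cliqueLoops {N : ℕ} (B : Finset (Fin N)) : Finset (Fin N) :=
  B.filter fun i => ∃ j ∈ B, j.val = i.val + 1

/-- A generalized linear diagram on `d * n` points of a line: the points are split into cliques `K_d`,
that is, into blocks of exactly `d` points each (so that for `d ≥ 1` there are `n` of them). -/
def Diagram (d n : ℕ) : Type :=
  {P : Finpartition (Finset.univ : Finset (Fin (d * n))) // ∀ B ∈ P.parts, B.card = d}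

/-- The number of loops of a diagram, counted clique by clique
(every loop lies in exactly one clique). -/
def Diagram.loops {d n : ℕ} (D : Diagram d n) : ℕ :=
  ∑ B ∈ D.1.parts, (cliqueLoops B).card

/-- The number of cliques of a diagram that contain at least one loop. -/
def Diagram.loopyCliques {d n : ℕ} (D : Diagram d n) : ℕ :=
  (D.1.parts.filter fun B => (cliqueLoops B).Nonempty).card

/-- `a_{n,k}^{(d)}`: the number of linear diagrams with `n` cliques `K_d` and `k` loops;
it is `0` for `n < 0`. -/
def a (d : ℕ) (n : ℤ) (k : ℕ) : ℕ :=
  if 0 ≤ n then Nat.card {D : Diagram d n.toNat // D.loops = k} else 0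

/-- `a_{n,k,l}^{(d)}`: the number of linear diagrams with `n` cliques `K_d` and `k` loops, these loops
being distributed over exactly `l` cliques. -/
def aSpread (d n k l : ℕ) : ℕ :=
  Nat.card {D : Diagram d n // D.loops = k ∧ D.loopyCliques = l}

/-- The binomial coefficient with integer arguments; it is `0` when the lower one is negative. -/
def binom (x y : ℤ) : ℤ :=
  if 0 ≤ y then Ring.choose x y.toNat else 0

/-- The coefficients `c_{n,k,t}^{(d)}`. -/
def c (d : ℕ) (n : ℤ) (k t : ℕ) : ℤ :=
  ∑ i ∈ Finset.range d,
    ((d - 1).choose i : ℤ) * binom t ((t : ℤ) + i - k) *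
      binom (d * (n - 1) - t) ((d : ℤ) - 2 * i - t + k - 1)

open Classical in
/-- The ordered multisets `R = {r_1 ≤ … ≤ r_l}` with `1 ≤ r_i ≤ d - 1` and `∑ (d - r_i) = k`. -/
def multisets (d k l : ℕ) : Finset (Fin l → ℕ) :=
  (Fintype.piFinset fun _ => Finset.Icc 1 (d - 1)).filter fun r =>
    Monotone r ∧ ∑ i, (d - r i) = k

/-- `α_R`. -/
def alpha (d : ℕ) {l : ℕ} (r : Fin l → ℕ) : ℕ :=
  ∏ i, (d - 1).choose (r i - 1)

/-- `β_u`, the multiplicity of `u` in `R`. -/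
def beta {l : ℕ} (r : Fin l → ℕ) (u : ℕ) : ℕ :=
  (Finset.univ.filter fun i => r i = u).card

/-- The nested sum over `j_i`, `s_i` (`1 ≤ i ≤ l - 1`) for the list `r_1, …, r_l`, started at
`v_1 = v`, `m_1 = m`, with `m_{i+1} = m_i + j_i - s_i` and `v_{i+1} = v_i + r_i`. The last member
of the list contributes the factor `binom (v_l - m_l) (r_l - m_l)`. -/
def pNested : ℤ → ℕ → List ℕ → ℤ
  | _, _, [] => 0
  | v, m, [r] => binom (v - m) ((r : ℤ) - m)
  | v, m, r :: r' :: rs =>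
      ∑ j ∈ Finset.range r, ∑ s ∈ Finset.range (min m (r - j) + 1),
        (m.choose s : ℤ) * binom (v - m) ((r : ℤ) - j - s) * ((r - 1).choose j : ℤ) *
          pNested (v + r) (m + j - s) (r' :: rs)

/-- `p_{n,R,m}`. -/
def p (d : ℕ) (n : ℤ) {l : ℕ} (r : Fin l → ℕ) (m : ℕ) : ℤ :=
  pNested (d * (n - l) + 1) m (List.ofFn r)

/-- The right-hand side of the formula for loops lying in a single clique,
in the unknowns `x n k` in place of `a_{n,k}`. -/
def oneCliqueSum (d : ℕ) (x : ℤ → ℕ → ℚ) (n : ℤ) (k : ℕ) : ℚ :=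
  ((d - 1).choose k : ℚ) *
    ∑ m ∈ Finset.range (d - k + 1),
      (binom (d * (n - 1) + 1 - m) ((d : ℤ) - k - m) : ℚ) * x (n - 1) m

/-- The right-hand side of the formula for loops spread over `l > 1` cliques,
in the unknowns `x n k` in place of `a_{n,k}`. -/
def manyCliquesSum (d : ℕ) (x : ℤ → ℕ → ℚ) (n : ℤ) (k l : ℕ) : ℚ :=
  ∑ r ∈ multisets d k l,
    (alpha d r : ℚ) / (∏ u ∈ Finset.Icc 1 (d - 1), (Nat.factorial (beta r u) : ℚ)) *
      ∑ m ∈ Finset.range (l * d - k + 1), (p d n r m : ℚ) * x (n - l) m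

/-- The elimination of the unknowns `x n m` with `m ≥ d`: starting from the unknowns with
index `0 ≤ k ≤ d - 1` only, those with `m = k + d - 1 ≥ d` are expressed by solving the recurrence
for `x (n + 1) k` for its last term. Values at `n < 0` (and, for `d < 2`, where there are
no loops, at `m ≥ d`) are `0`. -/
def elim (d : ℕ) (x : ℤ → ℕ → ℚ) (n : ℤ) (m : ℕ) : ℚ :=
  if m < d then x n m
  else if _hd : n < 0 ∨ d < 2 then 0
  else
    (elim d x (n + 1) (m + 1 - d) -
        ∑ t ∈ (Finset.Ico (m + 2 - 2 * d) m).attach,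
          (c d (n + 1) (m + 1 - d) t.1 : ℚ) * elim d x n t.1) /
      (c d (n + 1) (m + 1 - d) m : ℚ)
termination_by m
decreasing_by
  · omega
  · exact (Finset.mem_Ico.mp t.2).2

/-- The closed recurrence system in the sequences `x n k`, `0 ≤ k ≤ d - 1`, together with the
initial conditions: only the unknowns `x n k` with `k < d` occur in it. -/
structure IsClosedSystemSolution (d : ℕ) (x : ℤ → ℕ → ℚ) : Prop where
  neg : ∀ n : ℤ, n < 0 → ∀ k < d, x n k = 0
  init_zero : x 0 0 = 1
  init_pos : ∀ k, 1 ≤ k → k < d → x 0 k = 0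
  rec_zero : ∀ n : ℤ, 1 ≤ n →
    x n 0 = ∑ t ∈ Finset.range d, (c d n 0 t : ℚ) * x (n - 1) t
  rec_pos : ∀ n : ℤ, 1 ≤ n → ∀ k, 1 ≤ k → k < d →
    x n k = oneCliqueSum d x n k +
      ∑ l ∈ Finset.Icc 2 k, manyCliquesSum d (elim d x) n k l

end LinearDiagram

end

/-! Name the `n` cliques by `n` letters. A diagram with named cliques is a word in which every
letter occurs `d` times, and a loop is a pair of equal neighbours. Every diagram has `n!` namings,
so all the numbers in question are word counts divided by `n!` (`card_words_nsmul`).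

The core is an insertion count. Put `r` copies of a new letter into a word with `m` loops and `v`
gaps, both ends included. If they form `r - j` runs and break `s` loops, there are `C(m,s)` choices
of broken loops, `C(v-m,r-j-s)` choices of other gaps and `C(r-1,j)` compositions of `r` into the
run lengths; the result has `m + j - s` loops (`card_insertionsWith`, `sum_insertions`).

For the recurrence (iv), delete the letter that stands first. Reinserting it forces one run at the
front, which breaks no loop; the count of the remaining choices is `c` (`card_insertions_front`,
`a_recurrence`).

For (i) and (ii), shrink every run to one letter. If the letters with loops have `r_1, …, r_l` runs,
`alpha` counts the words over a given loopless one (`card_collapse_eq`). The loopless words arise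
from words on the other `n - l` letters by inserting the `l` letters in turn, where the last one
must break all remaining loops: this is `pNested` (`card_words_loopless`). Counting pairs of a word
and a listing of its loopy letters with run numbers `r` yields the multiplicity factorials
(`aSpread_eq`).

For (v), the solved recurrence trades the index `m` in a row for `m - (d - 1)` in the next row and
smaller indices in the same row. The bound `m ≤ i * (d - 1)` in row `n - i` survives, so row `n` is
never reached (`elim_congr`), and induction on the row gives uniqueness. -/

namespace LinearDiagram

/-! ### Words: loops, runs and the collapsing of runs. -/

section Words

variable {ι : Type*} [DecidableEq ι]

/-- The number of pairs of neighbouring equal letters of a word. -/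
def wordLoops : List ι → ℕ
  | [] => 0
  | y :: w => (if w.head? = some y then 1 else 0) + wordLoops w

/-- The number of pairs of neighbouring letters of a word that are both equal to `x`. -/
def letterLoops (x : ι) : List ι → ℕ
  | [] => 0
  | y :: w => (if y = x ∧ w.head? = some x then 1 else 0) + letterLoops x w

/-- The number of maximal runs of the letter `x` in a word. -/
def letterRuns (x : ι) : List ι → ℕ
  | [] => 0
  | y :: w => (if y = x ∧ w.head? ≠ some x then 1 else 0) + letterRuns x w

/-- The word obtained by shrinking every maximal run to a single letter. -/
def collapse : List ι → List ι
  | [] => []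
  | y :: w => if w.head? = some y then collapse w else y :: collapse w

/-- The number of compositions of `c` into `r` positive parts. -/
def compositions : ℕ → ℕ → ℕ
  | 0, 0 => 1
  | 0, _ + 1 => 0
  | _ + 1, 0 => 0
  | c + 1, r + 1 => c.choose r

/-- Lower the first part by one: it either stays positive or disappears. Deleting the first letter
of a word has the same two outcomes for its first run, which is how this identity enters the counts
below. -/
lemma compositions_succ (c r : ℕ) :
    compositions (c + 1) (r + 1) = compositions c (r + 1) + compositions c r := by
  cases c <;> cases r <;> simp [compositions, Nat.choose_succ_succ, add_comm]

/-- Each occurrence of `x` either is followed by another `x`, which makes a loop, or ends a run. -/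
lemma letterRuns_add_letterLoops (x : ι) (w : List ι) :
    letterRuns x w + letterLoops x w = w.count x := by
  induction w with
  | nil => rfl
  | cons y w ih =>
    simp only [letterRuns, letterLoops, List.count_cons, beq_iff_eq]
    split_ifs <;> first | omega | (exfalso; tauto)

lemma wordLoops_le_length (w : List ι) : wordLoops w ≤ w.length := by
  induction w with
  | nil => rfl
  | cons y w ih =>
    simp only [wordLoops, List.length_cons]
    split_ifs <;> omega

lemma head?_collapse (w : List ι) : (collapse w).head? = w.head? := by
  induction w with
  | nil => rfl
  | cons y w ih =>
    simp only [collapse]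
    split_ifs with h
    · rw [ih, h]; rfl
    · rfl

lemma wordLoops_collapse (w : List ι) : wordLoops (collapse w) = 0 := by
  induction w with
  | nil => rfl
  | cons y w ih =>
    simp only [collapse]
    split_ifs with h
    · exact ih
    · simp [wordLoops, head?_collapse, h, ih]

lemma count_collapse (x : ι) (w : List ι) : (collapse w).count x = letterRuns x w := by
  induction w with
  | nil => rfl
  | cons y w ih =>
    simp only [collapse, letterRuns]
    by_cases h : w.head? = some y
    · rw [if_pos h, ih, if_neg (by rintro ⟨rfl, h'⟩; exact h' h), zero_add]
    · rw [if_neg h, List.count_cons, ih, add_comm]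
      congr 1
      by_cases hy : y = x
      · subst hy; simp [h]
      · simp [hy]

lemma sum_letterLoops (T : Finset ι) (w : List ι) (h : ∀ y ∈ w, y ∈ T) :
    ∑ x ∈ T, letterLoops x w = wordLoops w := by
  induction w with
  | nil => simp [letterLoops, wordLoops]
  | cons y w ih =>
    simp only [letterLoops, wordLoops, Finset.sum_add_distrib]
    rw [ih fun z hz => h z (List.mem_cons_of_mem _ hz)]
    congr 1
    rw [Finset.sum_eq_single_of_mem y (h y (by simp))]
    · simp
    · intro z _ hz
      simp [hz.symm]

/-- The words with letter multiplicities `μ`. -/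
def words (μ : Multiset ι) : Finset (List ι) := μ.lists.toFinset

lemma mem_words {μ : Multiset ι} {w : List ι} : w ∈ words μ ↔ (w : Multiset ι) = μ := by
  rw [words, Multiset.mem_toFinset, Multiset.mem_lists_iff]
  exact eq_comm

/-- The step shared by the inductive word counts: deletion of a known first letter. -/
lemma card_filter_cons (y : ι) (A B : Finset (List ι)) (h : ∀ w, w ∈ A ↔ ∃ v ∈ B, w = y :: v) :
    A.card = B.card := by
  rw [← Finset.card_image_of_injective B (List.cons_injective (a := y))]
  congr 1
  ext w
  simp [h, eq_comm]

/-- The number of words with letter multiplicities `ν` that collapse to `u`. -/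
lemma card_collapse_eq [Fintype ι] (ν : Multiset ι) (u : List ι) (hu : wordLoops u = 0) :
    ((words ν).filter fun w => collapse w = u).card =
      ∏ a, compositions (ν.count a) (u.count a) := by
  induction hc : ν.card generalizing ν u with
  | zero =>
    obtain rfl := Multiset.card_eq_zero.mp hc
    cases u with
    | nil =>
      have : (words (0 : Multiset ι)).filter (fun w => collapse w = []) = {[]} := by
        ext w
        simp only [Finset.mem_filter, mem_words, Multiset.coe_eq_zero, Finset.mem_singleton]
        constructor
        · exact fun h => h.1
        · rintro rfl; exact ⟨rfl, rfl⟩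
      rw [this]; simp [compositions]
    | cons a u =>
      rw [Finset.prod_eq_zero (Finset.mem_univ a) (by simp [compositions]), Finset.card_eq_zero,
        Finset.filter_eq_empty_iff]
      intro w hw
      rw [mem_words, Multiset.coe_eq_zero] at hw
      subst hw
      simp [collapse]
  | succ N ih =>
    cases u with
    | nil =>
      obtain ⟨a, ha⟩ := Multiset.card_pos_iff_exists_mem.mp (by omega : 0 < ν.card)
      obtain ⟨c, hc'⟩ := Nat.exists_eq_succ_of_ne_zero (Multiset.count_pos.mpr ha).ne'
      rw [Finset.prod_eq_zero (Finset.mem_univ a) (by rw [hc']; simp [compositions]),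
        Finset.card_eq_zero, Finset.filter_eq_empty_iff]
      intro w hw h
      have := head?_collapse w
      rw [h] at this
      cases w with
      | nil => rw [mem_words] at hw; subst hw; simp at ha
      | cons => simp at this
    | cons a u =>
      by_cases ha : a ∈ ν
      · obtain ⟨ν, rfl⟩ := Multiset.exists_cons_of_mem ha
        have hu' : u.head? ≠ some a ∧ wordLoops u = 0 := by
          simp only [wordLoops] at hu
          split_ifs at hu <;> simp_all
        have hN : ν.card = N := by simpa using hc
        -- After deletion of the leading `a`, the rest collapses to `a :: u` if its first run was
        -- longer than one letter, and to `u` otherwise. The second case is consistent because `u`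
        -- does not start with `a`.
        rw [card_filter_cons a _
          (((words ν).filter fun w => collapse w = a :: u) ∪ (words ν).filter fun w => collapse w = u),
          Finset.card_union_of_disjoint, ih ν (a :: u) hu hN, ih ν u hu'.2 hN,
          ← Finset.mul_prod_erase _ _ (Finset.mem_univ a),
          ← Finset.mul_prod_erase _ _ (Finset.mem_univ a),
          ← Finset.mul_prod_erase _ _ (Finset.mem_univ a)]
        · have h1 : ∀ b ∈ Finset.univ.erase a, compositions ((a ::ₘ ν).count b) ((a :: u).count b)
              = compositions (ν.count b) (u.count b) := fun b hb => by
            rw [Multiset.count_cons_of_ne (Finset.ne_of_mem_erase hb),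
              List.count_cons_of_ne (Finset.ne_of_mem_erase hb).symm]
          have h2 : ∀ b ∈ Finset.univ.erase a, compositions (ν.count b) ((a :: u).count b)
              = compositions (ν.count b) (u.count b) := fun b hb => by
            rw [List.count_cons_of_ne (Finset.ne_of_mem_erase hb).symm]
          rw [Finset.prod_congr rfl h1, Finset.prod_congr rfl h2, Multiset.count_cons_self,
            List.count_cons_self, compositions_succ, add_mul]
        · rw [Finset.disjoint_filter]
          intro w _ h1 h2
          rw [h1] at h2
          simpa using congrArg List.length h2
        · intro w
          simp only [Finset.mem_filter, Finset.mem_union, mem_words]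
          constructor
          · rintro ⟨h1, h2⟩
            cases w with
            | nil => simp [collapse] at h2
            | cons b w =>
              have hb : b = a := by
                have := head?_collapse (b :: w)
                rw [h2] at this
                simpa using this.symm
              subst hb
              refine ⟨w, ?_, rfl⟩
              have h1' : (w : Multiset ι) = ν := by
                rw [← Multiset.cons_coe] at h1
                exact (Multiset.cons_inj_right _).mp h1
              simp only [collapse] at h2
              split_ifs at h2
              · exact Or.inl ⟨h1', h2⟩
              · exact Or.inr ⟨h1', by simpa using h2⟩
          · rintro ⟨v, h, rfl⟩
            rcases h with ⟨h1, h2⟩ | ⟨h1, h2⟩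
            · have hv : v.head? = some a := by rw [← head?_collapse, h2]; rfl
              exact ⟨by rw [← Multiset.cons_coe, h1], by simp [collapse, hv, h2]⟩
            · have hv : v.head? ≠ some a := by rw [← head?_collapse, h2]; exact hu'.1
              exact ⟨by rw [← Multiset.cons_coe, h1], by simp [collapse, hv, h2]⟩
      · rw [Finset.prod_eq_zero (Finset.mem_univ a)
          (by rw [Multiset.count_eq_zero_of_notMem ha]; simp [compositions]), Finset.card_eq_zero,
          Finset.filter_eq_empty_iff]
        intro w hw h
        have := head?_collapse w
        rw [h] at this
        rw [mem_words] at hw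
        subst hw
        exact ha (Multiset.mem_coe.mpr (List.mem_of_mem_head? (by simpa using this.symm)))

/-! ### Insertion of copies of a new letter. -/

/-- The words obtained from `w` by inserting `r` letters `x`. -/
def insertions (x : ι) (w : List ι) (r : ℕ) : Finset (List ι) :=
  (words (Multiset.replicate r x + (w : Multiset ι))).filter fun v => v.filter (· ≠ x) = w

lemma mem_insertions {x : ι} {w : List ι} {r : ℕ} (hx : x ∉ w) {v : List ι} :
    v ∈ insertions x w r ↔ v.filter (· ≠ x) = w ∧ v.count x = r := by
  rw [insertions, Finset.mem_filter, mem_words]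
  constructor
  · rintro ⟨h1, h2⟩
    refine ⟨h2, ?_⟩
    have := congrArg (Multiset.count x) h1
    simpa [List.count_eq_zero_of_not_mem hx] using this
  · rintro ⟨h1, h2⟩
    refine ⟨?_, h1⟩
    ext y
    rw [Multiset.count_add, Multiset.count_replicate, Multiset.coe_count, Multiset.coe_count, ← h1]
    by_cases hy : y = x
    · subst hy
      simp [h2, List.count_eq_zero]
    · rw [List.count_filter (by simpa using hy), if_neg (Ne.symm hy), zero_add]

lemma nil_mem_insertions {x : ι} {w : List ι} {r : ℕ} (hx : x ∉ w) :
    [] ∈ insertions x w r ↔ w = [] ∧ r = 0 := by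
  rw [mem_insertions hx]; simp [eq_comm]

lemma cons_self_mem_insertions {x : ι} {w : List ι} {r : ℕ} (hx : x ∉ w) {v : List ι} :
    x :: v ∈ insertions x w r ↔ ∃ r', r = r' + 1 ∧ v ∈ insertions x w r' := by
  simp only [mem_insertions hx]
  constructor
  · rintro ⟨h1, h2⟩
    exact ⟨v.count x, by simpa using h2.symm, by simpa using h1, rfl⟩
  · rintro ⟨r', rfl, h1, h2⟩
    exact ⟨by simpa using h1, by simpa using h2⟩

lemma cons_mem_insertions {x y : ι} {w : List ι} {r : ℕ} (hx : x ∉ w) (hy : y ≠ x)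
    {v : List ι} :
    y :: v ∈ insertions x w r ↔ ∃ w', w = y :: w' ∧ v ∈ insertions x w' r := by
  constructor
  · rw [mem_insertions hx]
    rintro ⟨h1, h2⟩
    rw [List.filter_cons_of_pos (by simpa using hy)] at h1
    refine ⟨_, h1.symm, ?_⟩
    rw [mem_insertions (by simp)]
    exact ⟨rfl, by rwa [List.count_cons_of_ne hy] at h2⟩
  · rintro ⟨w', rfl, h⟩
    rw [mem_insertions (fun h' => hx (List.mem_cons_of_mem _ h'))] at h
    rw [mem_insertions hx, List.filter_cons_of_pos (by simpa using hy), h.1,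
      List.count_cons_of_ne hy]
    exact ⟨rfl, h.2⟩

lemma head?_of_mem_insertions {x : ι} {w : List ι} {r : ℕ} (hx : x ∉ w) {v : List ι}
    (hv : v ∈ insertions x w r) (h : v.head? ≠ some x) : v.head? = w.head? := by
  cases v with
  | nil => rw [nil_mem_insertions hx] at hv; rw [hv.1]
  | cons y v =>
    obtain ⟨w', rfl, -⟩ := (cons_mem_insertions hx (by simpa using h)).mp hv
    rfl

/-- Bounds for the numbers of loops and runs after an insertion. -/
lemma insertion_bounds {x : ι} (v : List ι) : ∀ {w : List ι} {r : ℕ}, x ∉ w →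
    v ∈ insertions x w r →
    wordLoops v + letterRuns x v ≤ wordLoops w + r ∧
    wordLoops w + r + (if v.head? = some x then 1 else 0) ≤ wordLoops v + 2 * letterRuns x v ∧
    letterRuns x v ≤ r ∧ (1 ≤ r → 1 ≤ letterRuns x v) := by
  -- With `s = wordLoops w + r - wordLoops v - letterRuns x v` broken loops, the first two bounds
  -- say `0 ≤ s` and that `s` is at most the number of runs not at the front: a run breaks at most
  -- one loop, a front run none.
  induction v with
  | nil =>
    intro w r hx hv
    obtain ⟨rfl, rfl⟩ := (nil_mem_insertions hx).mp hv
    simp [wordLoops, letterRuns]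
  | cons y v ih =>
    intro w r hx hv
    by_cases hy : y = x
    · subst hy
      obtain ⟨r', rfl, hv'⟩ := (cons_self_mem_insertions hx).mp hv
      have := ih hx hv'
      simp only [wordLoops, letterRuns, List.head?_cons, true_and, if_true]
      split_ifs at this ⊢ <;> grind
    · obtain ⟨w', rfl, hv'⟩ := (cons_mem_insertions hx hy).mp hv
      have hx' : x ∉ w' := fun h' => hx (List.mem_cons_of_mem _ h')
      have := ih hx' hv'
      have hh := head?_of_mem_insertions hx' hv'
      simp only [wordLoops, letterRuns, List.head?_cons, hy, false_and, if_false, Option.some_inj]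
      by_cases h1 : v.head? = some x
      · simp only [h1, if_true] at this ⊢
        have : ¬ (some x = some y) := by simpa using Ne.symm hy
        simp only [this, if_false]
        split_ifs <;> omega
      · simp only [h1, if_false] at this ⊢
        rw [hh h1]
        split_ifs <;> omega

/-- The insertions of `r` letters `x` in `u` runs which break `s` loops. -/
def insertionsWith (x : ι) (w : List ι) (r u s : ℕ) : Finset (List ι) :=
  (insertions x w r).filter fun v =>
    letterRuns x v = u ∧ wordLoops v + s + u = wordLoops w + r

/-- Delete one `x` from the front run: the run gets shorter or vanishes, matching
`compositions_succ`. The front run breaks no loop, so only `s + q` runs choose a gap. The count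
without a front run is a hypothesis so that this lemma is available for the tail inside the
induction that proves it. -/
lemma card_insertionsWith_front (x : ι) (w : List ι) (hx : x ∉ w)
    (h : ∀ r s q, ((insertionsWith x w r (s + q) s).filter fun v => v.head? ≠ some x).card =
      (wordLoops w).choose s * (w.length - wordLoops w).choose q * compositions r (s + q))
    (r s q : ℕ) :
    ((insertionsWith x w r (s + q + 1) s).filter fun v => v.head? = some x).card =
      (wordLoops w).choose s * (w.length - wordLoops w).choose q *
        compositions r (s + q + 1) := by
  induction r with
  | zero =>
    rw [compositions, mul_zero, Finset.card_eq_zero, Finset.filter_eq_empty_iff]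
    intro v hv hv'
    cases v with
    | nil => simp at hv'
    | cons y v =>
      obtain rfl : y = x := by simpa using hv'
      have := (cons_self_mem_insertions hx).mp (Finset.mem_filter.mp hv).1
      omega
  | succ r ih =>
    rw [compositions_succ, mul_add, ← ih, ← h, ← Finset.card_union_of_disjoint]
    · refine card_filter_cons x _ _ fun v => ?_
      simp only [Finset.mem_filter, Finset.mem_union, insertionsWith]
      constructor
      · rintro ⟨⟨h1, h2, h3⟩, h4⟩
        cases v with
        | nil => simp at h4
        | cons y v =>
          obtain rfl : y = x := by simpa using h4
          obtain ⟨r', hr, hv⟩ := (cons_self_mem_insertions hx).mp h1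
          obtain rfl : r = r' := by omega
          refine ⟨v, ?_, rfl⟩
          simp only [wordLoops, letterRuns, true_and] at h2 h3
          by_cases hh : v.head? = some y
          · simp only [hh, if_true, ne_eq, not_true, if_false] at h2 h3
            exact Or.inl ⟨⟨hv, by omega, by omega⟩, hh⟩
          · simp only [hh, if_false, ne_eq, not_false_eq_true, if_true] at h2 h3
            exact Or.inr ⟨⟨hv, by omega, by omega⟩, hh⟩
      · rintro ⟨v, hv, rfl⟩
        simp only [wordLoops, letterRuns, true_and, List.head?_cons, and_true]
        rcases hv with ⟨⟨h1, h2, h3⟩, h4⟩ | ⟨⟨h1, h2, h3⟩, h4⟩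
        · refine ⟨(cons_self_mem_insertions hx).mpr ⟨r, rfl, h1⟩, ?_, ?_⟩ <;> simp [h4] <;> omega
        · refine ⟨(cons_self_mem_insertions hx).mpr ⟨r, rfl, h1⟩, ?_, ?_⟩ <;> simp [h4] <;> omega
    · rw [Finset.disjoint_left]
      intro v h1 h2
      exact (Finset.mem_filter.mp h2).2 (Finset.mem_filter.mp h1).2

/-- Induction on `w`: without a front run, the first letter of `w` stays first and can be deleted.
The gap after it becomes the front gap of the tail. If that gap was a loop, using it or not is
Pascal's rule in `s`; otherwise it is Pascal's rule in `q`. -/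
lemma card_insertionsWith_not_front (x : ι) (w : List ι) (hx : x ∉ w) (r s q : ℕ) :
    ((insertionsWith x w r (s + q) s).filter fun v => v.head? ≠ some x).card =
      (wordLoops w).choose s * (w.length - wordLoops w).choose q * compositions r (s + q) := by
  induction w generalizing r s q with
  | nil =>
    by_cases h : r = 0 ∧ s = 0 ∧ q = 0
    · obtain ⟨rfl, rfl, rfl⟩ := h
      have : (insertionsWith x [] 0 (0 + 0) 0).filter (fun v => v.head? ≠ some x) = {[]} := by
        ext v
        simp only [insertionsWith, Finset.mem_filter, Finset.mem_singleton]
        constructor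
        · rintro ⟨⟨h1, -⟩, h2⟩
          have := head?_of_mem_insertions hx h1 h2
          cases v <;> simp_all
        · rintro rfl
          simp [nil_mem_insertions, letterRuns, wordLoops]
      rw [this]; simp [compositions, wordLoops]
    · have : (insertionsWith x [] r (s + q) s).filter (fun v => v.head? ≠ some x) = ∅ := by
        rw [Finset.filter_eq_empty_iff]
        intro v hv h2
        simp only [insertionsWith, Finset.mem_filter] at hv
        have := head?_of_mem_insertions hx hv.1 h2
        cases v with
        | nil =>
          rw [nil_mem_insertions hx] at hv
          simp [letterRuns, wordLoops] at hv
          omega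
        | cons => simp at this
      rw [this]
      cases s <;> cases q <;> cases r <;> simp_all [compositions, wordLoops]
  | cons y w ih =>
    have hx' : x ∉ w := fun h' => hx (List.mem_cons_of_mem _ h')
    have hy : y ≠ x := fun h => hx (by simp [h])
    have hfront := card_insertionsWith_front x w hx' (fun r s q => ih hx' r s q)
    have ih := ih hx'
    have hle := wordLoops_le_length w
    by_cases hh : w.head? = some y
    · have hm : wordLoops (y :: w) = wordLoops w + 1 := by simp [wordLoops, hh, add_comm]
      have key : ((insertionsWith x (y :: w) r (s + q) s).filter fun v => v.head? ≠ some x).card =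
          ((insertions x w r).filter fun v => v.head? = some x ∧ letterRuns x v = s + q ∧
            wordLoops v + s + (s + q) = wordLoops w + 1 + r).card +
          ((insertionsWith x w r (s + q) s).filter fun v => v.head? ≠ some x).card := by
        rw [← Finset.card_union_of_disjoint]
        · refine card_filter_cons y _ _ fun v => ?_
          simp only [Finset.mem_filter, Finset.mem_union, insertionsWith, hm]
          constructor
          · rintro ⟨⟨h1, h2, h3⟩, h4⟩
            cases v with
            | nil => simp [nil_mem_insertions hx] at h1
            | cons z v =>
              obtain ⟨w', hw', hv⟩ := (cons_mem_insertions hx (by simpa using h4)).mp h1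
              obtain ⟨rfl, rfl⟩ := List.cons.inj hw'
              refine ⟨v, ?_, rfl⟩
              simp only [wordLoops, letterRuns, hy, false_and, if_false, zero_add] at h2 h3
              by_cases hv' : v.head? = some x
              · rw [if_neg (by rw [hv']; simpa using hy.symm)] at h3
                exact Or.inl ⟨hv, hv', h2, by omega⟩
              · rw [if_pos (by rw [head?_of_mem_insertions hx' hv hv', hh])] at h3
                exact Or.inr ⟨⟨hv, h2, by omega⟩, hv'⟩
          · rintro ⟨v, hv, rfl⟩
            simp only [wordLoops, letterRuns, hy, false_and, if_false, zero_add, List.head?_cons]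
            rcases hv with ⟨h1, h2, h3, h4⟩ | ⟨⟨h1, h2, h3⟩, h4⟩
            · rw [if_neg (by rw [h2]; simpa using hy.symm)]
              exact ⟨⟨(cons_mem_insertions hx hy).mpr ⟨w, rfl, h1⟩, h3, by omega⟩, by simpa using hy⟩
            · rw [if_pos (by rw [head?_of_mem_insertions hx' h1 h4, hh])]
              exact ⟨⟨(cons_mem_insertions hx hy).mpr ⟨w, rfl, h1⟩, h2, by omega⟩, by simpa using hy⟩
        · rw [Finset.disjoint_left]
          intro v h1 h2
          exact (Finset.mem_filter.mp h2).2 (Finset.mem_filter.mp h1).2.1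
      rw [key, ih, hm, List.length_cons, Nat.add_sub_add_right]
      cases s with
      | zero =>
        rw [Finset.card_eq_zero.mpr]
        · simp
        · rw [Finset.filter_eq_empty_iff]
          rintro v hv ⟨-, h2, h3⟩
          have := (insertion_bounds v hx' hv).1
          omega
      | succ s =>
        have : ((insertions x w r).filter fun v => v.head? = some x ∧ letterRuns x v = s + 1 + q ∧
            wordLoops v + (s + 1) + (s + 1 + q) = wordLoops w + 1 + r) =
            (insertionsWith x w r (s + q + 1) s).filter fun v => v.head? = some x := by
          ext v
          simp only [Finset.mem_filter, insertionsWith]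
          constructor
          · rintro ⟨h1, h2, h3, h4⟩
            exact ⟨⟨h1, by omega, by omega⟩, h2⟩
          · rintro ⟨⟨h1, h3, h4⟩, h2⟩
            exact ⟨h1, h2, by omega, by omega⟩
        rw [this, hfront, Nat.choose_succ_succ, show s + 1 + q = s + q + 1 by omega]
        ring
    · have hm : wordLoops (y :: w) = wordLoops w := by simp [wordLoops, hh]
      have key : ((insertionsWith x (y :: w) r (s + q) s).filter fun v => v.head? ≠ some x).card =
          ((insertionsWith x w r (s + q) s).filter fun v => v.head? = some x).card +
          ((insertionsWith x w r (s + q) s).filter fun v => v.head? ≠ some x).card := by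
        rw [Finset.card_filter_add_card_filter_not]
        refine card_filter_cons y _ _ fun v => ?_
        simp only [Finset.mem_filter, insertionsWith, hm]
        constructor
        · rintro ⟨⟨h1, h2, h3⟩, h4⟩
          cases v with
          | nil => simp [nil_mem_insertions hx] at h1
          | cons z v =>
            obtain ⟨w', hw', hv⟩ := (cons_mem_insertions hx (by simpa using h4)).mp h1
            obtain ⟨rfl, rfl⟩ := List.cons.inj hw'
            refine ⟨v, ?_, rfl⟩
            simp only [wordLoops, letterRuns, hy, false_and, if_false, zero_add] at h2 h3
            have hv' : v.head? ≠ some y := fun hv' => by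
              by_cases h : v.head? = some x
              · rw [h] at hv'; exact hy (by simpa using hv'.symm)
              · exact hh (by rw [← head?_of_mem_insertions hx' hv h, hv'])
            rw [if_neg hv'] at h3
            exact ⟨hv, h2, by omega⟩
        · rintro ⟨v, ⟨hv, h2, h3⟩, rfl⟩
          simp only [wordLoops, letterRuns, hy, false_and, if_false, zero_add, List.head?_cons]
          have hv' : v.head? ≠ some y := fun hv' => by
            by_cases h : v.head? = some x
            · rw [h] at hv'; exact hy (by simpa using hv'.symm)
            · exact hh (by rw [← head?_of_mem_insertions hx' hv h, hv'])
          rw [if_neg hv']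
          exact ⟨⟨(cons_mem_insertions hx hy).mpr ⟨w, rfl, hv⟩, h2, by omega⟩, by simpa using hy⟩
      rw [key, ih, hm, List.length_cons, Nat.sub_add_comm hle]
      -- For `q = 0` all runs break loops, so none of them can be at the front.
      cases q with
      | zero =>
        rw [Finset.card_eq_zero.mpr]
        · simp
        · rw [Finset.filter_eq_empty_iff]
          intro v hv h
          simp only [Finset.mem_filter, insertionsWith] at hv
          have := (insertion_bounds v hx' hv.1).2.1
          rw [if_pos h] at this
          omega
      | succ q =>
        rw [← add_assoc, hfront, Nat.choose_succ_succ]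
        ring

end Words

/-! ### Insertion counts over all gaps, and words without loops. -/

section Words

variable {ι : Type*} [DecidableEq ι]

lemma letterLoops_le_wordLoops (x : ι) (w : List ι) : letterLoops x w ≤ wordLoops w := by
  induction w with
  | nil => rfl
  | cons y w ih =>
    simp only [letterLoops, wordLoops]
    split_ifs with h1 h2 <;> first | omega | (obtain ⟨rfl, h⟩ := h1; exact absurd h h2)

/-- The front gap is one of the gaps that are not loops; using it or not is once more Pascal's rule
in `q`. -/
lemma card_insertionsWith (x : ι) (w : List ι) (hx : x ∉ w) (r s q : ℕ) :
    (insertionsWith x w r (s + q) s).card =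
      (wordLoops w).choose s * (w.length + 1 - wordLoops w).choose q * compositions r (s + q) := by
  have hn := card_insertionsWith_not_front x w hx
  have hle := wordLoops_le_length w
  rw [← Finset.card_filter_add_card_filter_not (fun v : List ι => v.head? = some x), hn,
    Nat.sub_add_comm hle]
  cases q with
  | zero =>
    rw [Finset.card_eq_zero.mpr]
    · simp
    · rw [Finset.filter_eq_empty_iff]
      intro v hv h
      simp only [Finset.mem_filter, insertionsWith] at hv
      have := (insertion_bounds v hx hv.1).2.1
      rw [if_pos h] at this
      omega
  | succ q =>
    rw [← add_assoc, card_insertionsWith_front x w hx hn, Nat.choose_succ_succ]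
    ring

lemma binom_natCast (m n : ℕ) : binom m n = m.choose n := by
  simp [binom, Ring.choose_natCast]

lemma binom_of_neg (x : ℤ) {y : ℤ} (hy : y < 0) : binom x y = 0 := by
  rw [binom, if_neg (by omega)]

lemma compositions_of_lt {r j : ℕ} (hj : j < r) : compositions r (r - j) = (r - 1).choose j := by
  obtain ⟨t, rfl⟩ := Nat.exists_eq_add_of_lt hj
  rw [show j + t + 1 - j = t + 1 by omega, show j + t + 1 - 1 = t + j by omega,
    show j + t + 1 = (t + j) + 1 by omega]
  exact Nat.choose_symm_add

/-- The insertions are sorted by the number `j` of loops formed by `x` itself, that is `r` minus the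
number of runs, and by the number `s` of broken loops. This is one layer of `pNested`. -/
lemma sum_insertions (x : ι) (w : List ι) (hx : x ∉ w) {r : ℕ} (hr : 1 ≤ r) (φ : ℕ → ℤ) :
    ∑ v ∈ insertions x w r, φ (wordLoops v) =
      ∑ j ∈ Finset.range r, ∑ s ∈ Finset.range (min (wordLoops w) (r - j) + 1),
        ((wordLoops w).choose s : ℤ) *
          binom ((w.length : ℤ) + 1 - wordLoops w) ((r : ℤ) - j - s) *
          ((r - 1).choose j : ℤ) * φ (wordLoops w + j - s) := by
  have hle := wordLoops_le_length w
  rw [Finset.sum_sigma', ← Finset.sum_fiberwise_of_maps_to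
    (g := fun v => (⟨r - letterRuns x v, wordLoops w + r - wordLoops v - letterRuns x v⟩ :
      Σ _ : ℕ, ℕ))]
  · refine Finset.sum_congr rfl fun i hi => ?_
    obtain ⟨j, s⟩ := i
    simp only [Finset.mem_sigma, Finset.mem_range] at hi
    obtain ⟨hj, hs⟩ := hi
    obtain ⟨q, hq⟩ : ∃ q, r - j = s + q := ⟨r - j - s, by omega⟩
    have hfib : ((insertions x w r).filter fun v =>
        (⟨r - letterRuns x v, wordLoops w + r - wordLoops v - letterRuns x v⟩ :
          Σ _ : ℕ, ℕ) = ⟨j, s⟩) = insertionsWith x w r (s + q) s := by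
      ext v
      simp only [Finset.mem_filter, insertionsWith, Sigma.mk.injEq, heq_eq_eq]
      refine and_congr_right fun hv => ?_
      have := insertion_bounds v hx hv
      omega
    rw [hfib, Finset.sum_congr rfl (g := fun _ => φ (wordLoops w + j - s)), Finset.sum_const,
      card_insertionsWith x w hx, ← hq, compositions_of_lt hj,
      show (w.length : ℤ) + 1 - wordLoops w = ((w.length + 1 - wordLoops w : ℕ) : ℤ) by omega,
      show (r : ℤ) - j - s = (q : ℕ) by omega, binom_natCast]
    · push_cast [nsmul_eq_mul]; ring
    · intro v hv
      simp only [Finset.mem_filter, insertionsWith] at hv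
      congr 1
      omega
  · intro v hv
    have := insertion_bounds v hx hv
    have h1 := letterLoops_le_wordLoops x v
    have h2 := letterRuns_add_letterLoops x v
    have h3 := ((mem_insertions hx).mp hv).2
    simp only [Finset.mem_sigma, Finset.mem_range]
    omega

/-- No loop remains exactly when every run is a single letter and all loops of `w` are broken. With
more than `r` loops this is impossible, and the lower argument of `binom` is negative. -/
lemma card_insertions_loopless (x : ι) (w : List ι) (hx : x ∉ w) {r : ℕ} (hr : 1 ≤ r) :
    (((insertions x w r).filter fun v => wordLoops v = 0).card : ℤ) =
      binom ((w.length : ℤ) + 1 - wordLoops w) ((r : ℤ) - wordLoops w) := by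
  have hle := wordLoops_le_length w
  by_cases hm : wordLoops w ≤ r
  · obtain ⟨q, hq⟩ := Nat.exists_eq_add_of_le hm
    have : ((insertions x w r).filter fun v => wordLoops v = 0) =
        insertionsWith x w r (wordLoops w + q) (wordLoops w) := by
      ext v
      simp only [Finset.mem_filter, insertionsWith]
      refine and_congr_right fun hv => ?_
      have h1 := letterLoops_le_wordLoops x v
      have h2 := letterRuns_add_letterLoops x v
      have h3 := ((mem_insertions hx).mp hv).2
      omega
    rw [this, card_insertionsWith x w hx, ← hq, Nat.choose_self,
      show (w.length : ℤ) + 1 - wordLoops w = ((w.length + 1 - wordLoops w : ℕ) : ℤ) by omega,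
      show (r : ℤ) - wordLoops w = (q : ℕ) by omega, binom_natCast]
    have := compositions_of_lt (show 0 < r from hr)
    rw [Nat.sub_zero] at this
    simp [this]
  · rw [binom_of_neg _ (by omega), Finset.card_eq_zero.mpr, Nat.cast_zero]
    rw [Finset.filter_eq_empty_iff]
    intro v hv h
    have := insertion_bounds v hx hv
    omega

lemma sum_words_add_replicate {M : Type*} [AddCommMonoid M] (μ : Multiset ι) {x : ι} (hx : x ∉ μ)
    (r : ℕ) (φ : List ι → M) :
    ∑ v ∈ words (μ + Multiset.replicate r x), φ v =
      ∑ w ∈ words μ, ∑ v ∈ insertions x w r, φ v := by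
  rw [← Finset.sum_fiberwise_of_maps_to (g := fun v => v.filter (· ≠ x)) (t := words μ)]
  · refine Finset.sum_congr rfl fun w hw => ?_
    rw [mem_words] at hw
    rw [insertions, hw, add_comm]
  · intro v hv
    rw [mem_words] at hv ⊢
    rw [← Multiset.filter_coe, hv, Multiset.filter_add, Multiset.filter_eq_self.mpr, add_eq_left,
      Multiset.filter_eq_nil]
    · intro y hy
      simpa using Multiset.eq_of_mem_replicate hy
    · rintro y hy rfl
      exact hx hy

/-- The letters listed in `L`, with the given multiplicities. -/
def content (L : List (ι × ℕ)) : Multiset ι :=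
  (L.map fun q => Multiset.replicate q.2 q.1).sum

/-- The number of words without loops, obtained from the words with letter multiplicities `μ` by
successive insertion of further letters. -/
lemma card_words_loopless (L : List (ι × ℕ)) (hL : L ≠ []) (hnodup : (L.map Prod.fst).Nodup)
    (hpos : ∀ q ∈ L, 1 ≤ q.2) (μ : Multiset ι) (hμ : ∀ q ∈ L, q.1 ∉ μ) :
    (((words (μ + content L)).filter fun v => wordLoops v = 0).card : ℤ) =
      ∑ w ∈ words μ, pNested ((μ.card : ℤ) + 1) (wordLoops w) (L.map Prod.snd) := by
  have hnot : ∀ (μ : Multiset ι) (x : ι), x ∉ μ → ∀ w ∈ words μ, x ∉ w := by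
    intro μ x hx w hw h
    rw [mem_words] at hw
    exact hx (hw ▸ Multiset.mem_coe.mpr h)
  have hlen : ∀ (μ : Multiset ι), ∀ w ∈ words μ, w.length = μ.card := by
    intro μ w hw
    rw [mem_words] at hw
    rw [← hw, Multiset.coe_card]
  induction L generalizing μ with
  | nil => exact absurd rfl hL
  | cons q L ih =>
    obtain ⟨x, r⟩ := q
    have hx : x ∉ μ := hμ (x, r) (by simp)
    have hr : 1 ≤ r := hpos (x, r) (by simp)
    cases L with
    | nil =>
      rw [show content [(x, r)] = Multiset.replicate r x by simp [content],
        Finset.card_filter, Nat.cast_sum, sum_words_add_replicate μ hx]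
      refine Finset.sum_congr rfl fun w hw => ?_
      rw [← Nat.cast_sum, ← Finset.card_filter, card_insertions_loopless x w (hnot μ x hx w hw) hr,
        hlen μ w hw]
      rfl
    | cons q' L =>
      rw [List.map_cons, List.nodup_cons] at hnodup
      rw [show μ + content ((x, r) :: q' :: L) =
        (μ + Multiset.replicate r x) + content (q' :: L) by simp [content, add_assoc],
        ih (by simp) hnodup.2 (fun q hq => hpos q (List.mem_cons_of_mem _ hq)),
        sum_words_add_replicate μ hx]
      · refine Finset.sum_congr rfl fun w hw => ?_
        rw [sum_insertions x w (hnot μ x hx w hw) hr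
          (fun m => pNested _ m ((q' :: L).map Prod.snd)), hlen μ w hw]
        simp only [List.map_cons, pNested, Multiset.card_add, Multiset.card_replicate,
          Nat.cast_add, add_right_comm]
      · intro q hq h
        rcases Multiset.mem_add.mp h with h | h
        · exact hμ q (List.mem_cons_of_mem _ hq) h
        · have e : q.1 = x := Multiset.eq_of_mem_replicate h
          have h3 : q.1 ∈ (q' :: L).map Prod.fst := List.mem_map_of_mem hq
          rw [e] at h3
          exact hnodup.1 h3

/-- An inserted letter breaks at most one loop. This is what cuts the sum over `m` off at `l * d -
k`, the sum of the `r_i`. -/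
lemma pNested_of_sum_lt (rs : List ℕ) (v : ℤ) (m : ℕ) (h : rs.sum < m) : pNested v m rs = 0 := by
  induction rs generalizing v m with
  | nil => rfl
  | cons r rs ih =>
    cases rs with
    | nil =>
      simp only [List.sum_cons, List.sum_nil] at h
      exact binom_of_neg _ (by omega)
    | cons r' rs =>
      simp only [pNested]
      refine Finset.sum_eq_zero fun j hj => Finset.sum_eq_zero fun s hs => ?_
      rw [Finset.mem_range] at hj hs
      rw [List.sum_cons] at h
      rw [ih _ _ (by omega), mul_zero]

end Words

/-! ### From diagrams to words by labelling the cliques. -/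

section Labellings

lemma head?_ofFn_eq_some {ι : Type*} {N : ℕ} (f : Fin N → ι) (x : ι) :
    (List.ofFn f).head? = some x ↔ ∃ j, f j = x ∧ j.val = 0 := by
  cases N with
  | zero => simp
  | succ N => simp

variable {ι : Type*} [DecidableEq ι]

lemma letterLoops_ofFn (x : ι) {N : ℕ} (f : Fin N → ι) :
    letterLoops x (List.ofFn f) = (cliqueLoops (Finset.univ.filter fun i => f i = x)).card := by
  have key : ∀ {N : ℕ} (f : Fin N → ι), cliqueLoops (Finset.univ.filter fun i => f i = x) =
      Finset.univ.filter fun i => f i = x ∧ ∃ j, f j = x ∧ j.val = i.val + 1 := by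
    intro N f
    ext i
    simp [cliqueLoops]
  rw [key]
  induction N with
  | zero => simp [letterLoops]
  | succ N ih =>
    rw [List.ofFn_succ, letterLoops, ih, Fin.card_filter_univ_succ']
    simp only [head?_ofFn_eq_some, Fin.exists_fin_succ, Fin.val_succ, Fin.val_zero, Nat.add_right_cancel_iff,
      zero_add]
    congr 1
    · simp
    · congr 1
      ext i
      simp

lemma Diagram.card_parts {d n : ℕ} (hd : 1 ≤ d) (D : Diagram d n) : D.1.parts.card = n := by
  have h := D.1.sum_card_parts
  rw [Finset.sum_congr rfl D.2, Finset.sum_const, Finset.card_univ, Fintype.card_fin,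
    smul_eq_mul, mul_comm] at h
  exact Nat.eq_of_mul_eq_mul_left hd h

/-- The clique of a diagram that contains the given point. -/
def Diagram.cliqueOf {d n : ℕ} (D : Diagram d n) (i : Fin (d * n)) : D.1.parts :=
  ⟨D.1.part i, D.1.part_mem.mpr (Finset.mem_univ i)⟩

lemma Diagram.cliqueOf_eq_iff {d n : ℕ} (D : Diagram d n) (i : Fin (d * n)) (B : D.1.parts) :
    D.cliqueOf i = B ↔ i ∈ B.1 := by
  rw [Diagram.cliqueOf, Subtype.ext_iff]
  exact D.1.part_eq_iff_mem B.2

/-- The word of a diagram whose cliques are labelled by the letters in `T`. -/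
def Diagram.word {d n : ℕ} {T : Finset ι} (D : Diagram d n) (e : D.1.parts ≃ T) : List ι :=
  List.ofFn fun i => (e (D.cliqueOf i) : ι)

lemma Diagram.filter_label {d n : ℕ} {T : Finset ι} (D : Diagram d n) (e : D.1.parts ≃ T) (x : T) :
    (Finset.univ.filter fun i => (e (D.cliqueOf i) : ι) = x) = (e.symm x).1 := by
  ext i
  rw [Finset.mem_filter, ← D.cliqueOf_eq_iff, ← Subtype.ext_iff, Equiv.eq_symm_apply]
  simp

lemma Diagram.letterLoops_word {d n : ℕ} {T : Finset ι} (D : Diagram d n) (e : D.1.parts ≃ T)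
    (x : T) : letterLoops (x : ι) (D.word e) = (cliqueLoops (e.symm x).1).card := by
  rw [Diagram.word, letterLoops_ofFn, D.filter_label]

lemma count_ofFn {N : ℕ} (f : Fin N → ι) (x : ι) :
    (List.ofFn f).count x = (Finset.univ.filter fun i => f i = x).card := by
  rw [← Multiset.coe_count, ← Fin.univ_val_map, Multiset.count_map, Finset.card_def,
    Finset.filter_val]
  simp only [eq_comm]

lemma mem_words_nsmul {d : ℕ} {T : Finset ι} {w : List ι} :
    w ∈ words (d • T.val) ↔ ∀ x, w.count x = if x ∈ T then d else 0 := by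
  rw [mem_words, Multiset.ext]
  refine forall_congr' fun x => ?_
  rw [Multiset.coe_count, Multiset.count_nsmul, Multiset.count_eq_of_nodup T.nodup]
  simp

lemma Diagram.word_mem_words {d n : ℕ} {T : Finset ι} (D : Diagram d n) (e : D.1.parts ≃ T) :
    D.word e ∈ words (d • T.val) := by
  rw [mem_words_nsmul]
  intro x
  rw [Diagram.word, count_ofFn]
  split_ifs with hx
  · rw [D.filter_label e ⟨x, hx⟩]
    exact D.2 _ (e.symm ⟨x, hx⟩).2
  · rw [Finset.card_eq_zero, Finset.filter_eq_empty_iff]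
    rintro i - rfl
    exact hx (e _).2

lemma Diagram.wordLoops_word {d n : ℕ} {T : Finset ι} (D : Diagram d n) (e : D.1.parts ≃ T) :
    wordLoops (D.word e) = D.loops := by
  rw [← sum_letterLoops T, ← Finset.sum_coe_sort]
  · refine Eq.trans ?_ (Finset.sum_coe_sort D.1.parts fun B => (cliqueLoops B).card)
    refine Eq.trans ?_ (e.symm.sum_comp fun B => (cliqueLoops B.1).card)
    exact Finset.sum_congr rfl fun x _ => D.letterLoops_word e x
  · intro y hy
    obtain ⟨i, rfl⟩ := List.mem_ofFn.mp hy
    exact (e _).2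

lemma Diagram.card_loopy_word {d n : ℕ} {T : Finset ι} (D : Diagram d n) (e : D.1.parts ≃ T) :
    (T.filter fun x => letterLoops x (D.word e) ≠ 0).card = D.loopyCliques := by
  rw [Finset.card_filter, ← Finset.sum_coe_sort, Diagram.loopyCliques, Finset.card_filter]
  refine Eq.trans ?_ (Finset.sum_coe_sort D.1.parts fun B =>
    if (cliqueLoops B).Nonempty then 1 else 0)
  refine Eq.trans ?_ (e.symm.sum_comp fun B => if (cliqueLoops B.1).Nonempty then 1 else 0)
  refine Finset.sum_congr rfl fun x _ => ?_
  rw [D.letterLoops_word e x]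
  simp [Finset.nonempty_iff_ne_empty]

/-- The clique labelled `x` is the set of positions of `x`, so the word determines both the
partition and the labelling. -/
lemma Diagram.word_injective {d n : ℕ} {T : Finset ι} :
    Function.Injective fun z : (Σ D : Diagram d n, (D.1.parts ≃ T)) => z.1.word z.2 := by
  rintro ⟨D, e⟩ ⟨D', e'⟩ h
  have h : ∀ i, e (D.cliqueOf i) = e' (D'.cliqueOf i) :=
    fun i => Subtype.ext (congrFun (List.ofFn_injective h) i)
  have hsymm : ∀ x : T, (e.symm x).1 = (e'.symm x).1 := by
    intro x
    rw [← D.filter_label e x, ← D'.filter_label e' x]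
    simp only [h]
  have hD : D = D' := by
    apply Subtype.ext
    apply Finpartition.ext
    ext B
    constructor
    · intro hB
      have := hsymm (e ⟨B, hB⟩)
      rw [e.symm_apply_apply] at this
      have h' := (e'.symm (e ⟨B, hB⟩)).2
      rwa [← this] at h'
    · intro hB
      have := hsymm (e' ⟨B, hB⟩)
      rw [e'.symm_apply_apply] at this
      have h' := (e.symm (e' ⟨B, hB⟩)).2
      rwa [this] at h'
  subst hD
  have : e.symm = e'.symm := Equiv.ext fun x => Subtype.ext (hsymm x)
  rw [← e.symm_symm, this, e'.symm_symm]

/-- The blocks are the sets of positions of the letters; `d ≥ 1` makes them nonempty and different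
letters give different blocks. -/
lemma Diagram.word_surjective {d n : ℕ} (hd : 1 ≤ d) {T : Finset ι} (hT : T.card = n)
    {w : List ι} (hw : w ∈ words (d • T.val)) :
    ∃ (D : Diagram d n) (e : D.1.parts ≃ T), D.word e = w := by
  have hlen : w.length = d * n := by
    have := congrArg Multiset.card (mem_words.mp hw)
    simpa [hT] using this
  obtain ⟨f, rfl⟩ : ∃ f : Fin (d * n) → ι, List.ofFn f = w :=
    ⟨fun i => w.get (i.cast hlen.symm), by
      rw [List.ofFn_congr hlen.symm]; exact List.ofFn_get w⟩
  rw [mem_words_nsmul] at hw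
  simp only [count_ofFn] at hw
  have hmem : ∀ i, f i ∈ T := by
    intro i
    by_contra h
    have := hw (f i)
    rw [if_neg h, Finset.card_eq_zero, Finset.filter_eq_empty_iff] at this
    exact this (Finset.mem_univ i) rfl
  have hcard : ∀ x ∈ T, (Finset.univ.filter fun i => f i = x).card = d :=
    fun x hx => by rw [hw, if_pos hx]
  let Q : Finpartition (Finset.univ : Finset (Fin (d * n))) := Finpartition.ofExistsUnique
    (T.image fun x => Finset.univ.filter fun i => f i = x) (fun _ _ => Finset.subset_univ _)
    (fun i _ => ⟨Finset.univ.filter fun j => f j = f i,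
      ⟨Finset.mem_image_of_mem _ (hmem i), by simp⟩, by
        rintro B ⟨hB, hi⟩
        obtain ⟨x, -, rfl⟩ := Finset.mem_image.mp hB
        rw [(Finset.mem_filter.mp hi).2]⟩)
    (by
      intro h
      obtain ⟨x, hx, h⟩ := Finset.mem_image.mp h
      have := hcard x hx
      rw [h, Finset.card_empty] at this
      omega)
  have hQ : Q.parts = T.image fun x => Finset.univ.filter fun i => f i = x := rfl
  let D : Diagram d n := ⟨Q, by
    intro B hB
    obtain ⟨x, hx, rfl⟩ := Finset.mem_image.mp (hQ ▸ hB)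
    exact hcard x hx⟩
  let g : T → D.1.parts := fun x =>
    ⟨Finset.univ.filter fun i => f i = x, Finset.mem_image_of_mem _ x.2⟩
  have hg : Function.Bijective g := by
    constructor
    · intro x y hxy
      have h : (Finset.univ.filter fun i => f i = (x : ι)) =
        Finset.univ.filter fun i => f i = (y : ι) := congrArg Subtype.val hxy
      obtain ⟨i, hi⟩ := Finset.card_pos.mp (by rw [hcard x x.2]; omega)
      have hi' := h ▸ hi
      exact Subtype.ext ((Finset.mem_filter.mp hi).2.symm.trans (Finset.mem_filter.mp hi').2)
    · rintro ⟨B, hB⟩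
      obtain ⟨x, hx, rfl⟩ := Finset.mem_image.mp (hQ ▸ hB)
      exact ⟨⟨x, hx⟩, rfl⟩
  refine ⟨D, (Equiv.ofBijective g hg).symm, ?_⟩
  rw [Diagram.word]
  congr 1
  funext i
  have : (Equiv.ofBijective g hg).symm (D.cliqueOf i) = ⟨f i, hmem i⟩ := by
    rw [Equiv.symm_apply_eq, D.cliqueOf_eq_iff]
    simp [g]
  rw [this]

/-- Labelling the cliques of a diagram by the letters in `T` turns diagrams into words. -/
lemma card_words_nsmul {d n : ℕ} (hd : 1 ≤ d) {T : Finset ι} (hT : T.card = n) (P : ℕ → ℕ → Prop)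
    [∀ w : List ι, Decidable (P (wordLoops w) (T.filter fun x => letterLoops x w ≠ 0).card)] :
    ((words (d • T.val)).filter fun w =>
      P (wordLoops w) (T.filter fun x => letterLoops x w ≠ 0).card).card =
      n.factorial * Nat.card {D : Diagram d n // P D.loops D.loopyCliques} := by
  let F : (Σ D : {D : Diagram d n // P D.loops D.loopyCliques}, (D.1.1.parts ≃ T)) →
      ((words (d • T.val)).filter fun w =>
        P (wordLoops w) (T.filter fun x => letterLoops x w ≠ 0).card : Finset (List ι)) :=
    fun z => ⟨z.1.1.word z.2, by
      rw [Finset.mem_filter, z.1.1.wordLoops_word, z.1.1.card_loopy_word]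
      exact ⟨z.1.1.word_mem_words z.2, z.1.2⟩⟩
  have hF : Function.Bijective F := by
    constructor
    · rintro ⟨⟨D, hD⟩, e⟩ ⟨⟨D', hD'⟩, e'⟩ h
      have := Diagram.word_injective (a₁ := ⟨D, e⟩) (a₂ := ⟨D', e'⟩) (congrArg Subtype.val h)
      cases this
      rfl
    · rintro ⟨w, hw⟩
      rw [Finset.mem_filter] at hw
      obtain ⟨D, e, rfl⟩ := Diagram.word_surjective hd hT hw.1
      rw [D.wordLoops_word, D.card_loopy_word] at hw
      exact ⟨⟨⟨D, hw.2⟩, e⟩, rfl⟩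
  -- All diagrams have exactly `n` cliques, hence equally many labellings, `n!`.
  have hE : ∀ D : {D : Diagram d n // P D.loops D.loopyCliques},
      Nonempty ((D.1.1.parts ≃ T) ≃ Equiv.Perm (Fin n)) := fun D =>
    ⟨Equiv.equivCongr (Finset.equivFinOfCardEq (D.1.card_parts hd)) (Finset.equivFinOfCardEq hT)⟩
  rw [← Nat.card_eq_finsetCard, ← Nat.card_congr (Equiv.ofBijective F hF),
    Nat.card_congr ((Equiv.sigmaCongrRight fun D => (hE D).some).trans (Equiv.sigmaEquivProd _ _)),
    Nat.card_prod, Nat.card_eq_fintype_card (α := Equiv.Perm (Fin n)), Fintype.card_perm,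
    Fintype.card_fin, mul_comm]

lemma card_words_wordLoops {d n : ℕ} (hd : 1 ≤ d) {T : Finset ι} (hT : T.card = n) (k : ℕ) :
    ((words (d • T.val)).filter fun w => wordLoops w = k).card = n.factorial * a d n k := by
  rw [card_words_nsmul hd hT fun m _ => m = k, a, if_pos (by omega)]
  rfl

lemma card_words_spread {d n : ℕ} (hd : 1 ≤ d) {T : Finset ι} (hT : T.card = n) (k l : ℕ) :
    ((words (d • T.val)).filter fun w =>
      wordLoops w = k ∧ (T.filter fun x => letterLoops x w ≠ 0).card = l).card =
      n.factorial * aSpread d n k l :=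
  card_words_nsmul hd hT fun m m' => m = k ∧ m' = l

/-- The sum of a function of the number of loops over all words of labelled diagrams. -/
lemma sum_words_wordLoops {d n : ℕ} (hd : 1 ≤ d) {T : Finset ι} (hT : T.card = n)
    (S : Finset ℕ) (φ : ℕ → ℚ) (hφ : ∀ m ∉ S, φ m = 0) :
    ∑ w ∈ words (d • T.val), φ (wordLoops w) = n.factorial * ∑ m ∈ S, φ m * a d n m := by
  rw [← Finset.sum_filter_of_ne (p := fun w => wordLoops w ∈ S)
    (fun w _ h => by by_contra h'; exact h (hφ _ h')),
    ← Finset.sum_fiberwise_of_maps_to (g := wordLoops) (t := S)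
      (fun w hw => (Finset.mem_filter.mp hw).2), Finset.mul_sum]
  refine Finset.sum_congr rfl fun m hm => ?_
  rw [Finset.filter_filter, Finset.filter_congr (q := fun w => wordLoops w = m)
    (fun w _ => ⟨fun h => h.2, fun h => ⟨h ▸ hm, h⟩⟩),
    Finset.sum_congr rfl (g := fun _ => φ m) (fun w hw => by rw [(Finset.mem_filter.mp hw).2]),
    Finset.sum_const, card_words_wordLoops hd hT, nsmul_eq_mul]
  push_cast
  ring

end Labellings

/-! ### The general recurrence: removal of the first clique. -/

section Recurrence

lemma c_eq_zero {d : ℕ} {n : ℤ} {k t : ℕ} (h : t + d ≤ k ∨ k + d ≤ t) : c d n k t = 0 := by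
  refine Finset.sum_eq_zero fun i hi => ?_
  rw [Finset.mem_range] at hi
  rcases h with h | h
  · rw [binom_of_neg (t : ℤ) (by omega), mul_zero, zero_mul]
  · rw [binom_of_neg _ (by omega : (d : ℤ) - 2 * i - t + k - 1 < 0), mul_zero]

/-- Here `i` is `d` minus the number of runs. Ending with `k` loops forces `s = wordLoops w + i - k`
broken loops, and the front run leaves `q = d - i - s - 1` runs for other gaps. These are the lower
arguments in `c`. -/
lemma card_insertions_front {ι : Type*} [DecidableEq ι] (x : ι) (w : List ι) (hx : x ∉ w)
    {d n : ℕ} (hd : 1 ≤ d) (hw : (w.length : ℤ) = d * ((n : ℤ) - 1)) (k : ℕ) :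
    (((insertions x w d).filter fun v => v.head? = some x ∧ wordLoops v = k).card : ℤ) =
      c d n k (wordLoops w) := by
  have hle := wordLoops_le_length w
  rw [Finset.card_eq_sum_card_fiberwise (f := fun v => d - letterRuns x v) (t := Finset.range d),
    Nat.cast_sum, c]
  · refine Finset.sum_congr rfl fun i hi => ?_
    rw [Finset.mem_range] at hi
    rw [Finset.filter_filter]
    -- The two conditions say `s ≥ 0` and `q ≥ 0`. If one fails, no insertion exists and a binomial
    -- has a negative lower argument.
    by_cases h : k ≤ wordLoops w + i ∧ wordLoops w + i + 1 ≤ k + (d - i)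
    · obtain ⟨s, hs⟩ := Nat.exists_eq_add_of_le h.1
      obtain ⟨q, hq⟩ : ∃ q, d - i = s + q + 1 := ⟨d - i - s - 1, by omega⟩
      have : ((insertions x w d).filter fun v =>
          (v.head? = some x ∧ wordLoops v = k) ∧ d - letterRuns x v = i) =
          (insertionsWith x w d (s + q + 1) s).filter fun v => v.head? = some x := by
        ext v
        simp only [Finset.mem_filter, insertionsWith]
        constructor
        · rintro ⟨hv, ⟨h1, h2⟩, h3⟩
          have := insertion_bounds v hx hv
          exact ⟨⟨hv, by omega, by omega⟩, h1⟩
        · rintro ⟨⟨hv, h1, h2⟩, h3⟩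
          exact ⟨hv, ⟨h3, by omega⟩, by omega⟩
      rw [this, card_insertionsWith_front x w hx (card_insertionsWith_not_front x w hx), ← hq,
        compositions_of_lt hi, ← hw,
        show ((wordLoops w : ℕ) : ℤ) + i - k = s by omega,
        show (w.length : ℤ) - wordLoops w = ((w.length - wordLoops w : ℕ) : ℤ) by omega,
        show (d : ℤ) - 2 * i - wordLoops w + k - 1 = q by omega, binom_natCast, binom_natCast]
      push_cast
      ring
    · have : ((insertions x w d).filter fun v =>
          (v.head? = some x ∧ wordLoops v = k) ∧ d - letterRuns x v = i) = ∅ := by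
        rw [Finset.filter_eq_empty_iff]
        rintro v hv ⟨⟨h1, h2⟩, h3⟩
        have := insertion_bounds v hx hv
        rw [if_pos h1] at this
        omega
      rw [this, Finset.card_empty, Nat.cast_zero]
      by_cases h1 : k ≤ wordLoops w + i
      · rw [binom_of_neg _ (by omega : (d : ℤ) - 2 * i - wordLoops w + k - 1 < 0), mul_zero]
      · rw [binom_of_neg (wordLoops w : ℤ) (by omega), mul_zero, zero_mul]
  · intro v hv
    have := insertion_bounds v hx (Finset.mem_filter.mp hv).1
    simp only [Finset.coe_range, Set.mem_Iio]
    omega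

lemma nsmul_val_eq_erase {ι : Type*} [DecidableEq ι] (d : ℕ) {T : Finset ι} {x : ι} (hx : x ∈ T) :
    d • T.val = d • (T.erase x).val + Multiset.replicate d x := by
  rw [Finset.erase_val, ← Multiset.nsmul_singleton, ← nsmul_add, add_comm,
    Multiset.singleton_add, Multiset.cons_erase hx]

/-- Removal of the clique that contains the first point. -/
lemma a_recurrence {d n : ℕ} (hd : 1 ≤ d) (hn : 1 ≤ n) (k : ℕ) :
    (a d n k : ℚ) = ∑ t ∈ Finset.Icc (k + 1 - d) (k + d - 1),
      (c d n k t : ℚ) * (a d ((n : ℤ) - 1) t : ℚ) := by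
  have hcast : ((n : ℤ) - 1) = ((n - 1 : ℕ) : ℤ) := by omega
  have key : ∀ x : Fin n, (((words (d • (Finset.univ : Finset (Fin n)).val)).filter fun v =>
      v.head? = some x ∧ wordLoops v = k).card : ℚ) =
      (n - 1).factorial * ∑ t ∈ Finset.Icc (k + 1 - d) (k + d - 1),
        (c d n k t : ℚ) * a d ((n : ℤ) - 1) t := by
    intro x
    have hx : x ∉ d • (Finset.univ.erase x).val := fun h =>
      Finset.notMem_erase x _ (Multiset.mem_of_mem_nsmul h)
    rw [nsmul_val_eq_erase d (Finset.mem_univ x), Finset.card_filter, Nat.cast_sum,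
      sum_words_add_replicate _ hx, hcast,
      ← sum_words_wordLoops hd (T := Finset.univ.erase x) (by simp)]
    · refine Finset.sum_congr rfl fun w hw => ?_
      rw [mem_words] at hw
      rw [← Nat.cast_sum, ← Finset.card_filter, ← card_insertions_front x w
        (fun h => hx (hw ▸ Multiset.mem_coe.mpr h)) hd, Int.cast_natCast]
      have := congrArg Multiset.card hw
      rw [Multiset.coe_card, Multiset.card_nsmul, Finset.card_val,
        Finset.card_erase_of_mem (Finset.mem_univ x), Finset.card_univ, Fintype.card_fin] at this
      rw [this, hcast]
      push_cast
      rfl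
    · intro m hm
      rw [Finset.mem_Icc] at hm
      rw [c_eq_zero (by omega), Int.cast_zero]
  have hsum := card_words_wordLoops hd (n := n) (T := (Finset.univ : Finset (Fin n))) (by simp) k
  have hsplit : ((words (d • (Finset.univ : Finset (Fin n)).val)).filter fun w =>
      wordLoops w = k).card = ∑ x : Fin n, ((words (d • (Finset.univ : Finset (Fin n)).val)).filter
        fun v => v.head? = some x ∧ wordLoops v = k).card := by
    rw [← Finset.card_biUnion]
    · congr 1
      ext v
      simp only [Finset.mem_filter, Finset.mem_biUnion, Finset.mem_univ, true_and]
      constructor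
      · rintro ⟨hv, h⟩
        cases v with
        | nil =>
          have := congrArg Multiset.card (mem_words.mp hv)
          simp at this
          omega
        | cons x v => exact ⟨x, hv, rfl, h⟩
      · rintro ⟨x, hv, -, h⟩
        exact ⟨hv, h⟩
    · intro x _ y _ hxy
      rw [Function.onFun, Finset.disjoint_filter]
      rintro v - ⟨h1, -⟩ ⟨h2, -⟩
      rw [h1] at h2
      exact hxy (Option.some_inj.mp h2)
  -- The `n` choices of the first letter turn the `(n-1)!` labellings of the rest into the `n!` on
  -- the left.
  have hQ : ((n.factorial * a d n k : ℕ) : ℚ) = _ := congrArg Nat.cast (hsum.symm.trans hsplit)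
  rw [Nat.cast_sum, Finset.sum_congr rfl fun x _ => key x, Finset.sum_const, Finset.card_univ,
    Fintype.card_fin, nsmul_eq_mul, ← mul_assoc, ← Nat.cast_mul, Nat.mul_factorial_pred (by omega),
    Nat.cast_mul] at hQ
  exact mul_left_cancel₀ (Nat.cast_ne_zero.mpr n.factorial_ne_zero) hQ

/-- At `t = k + d - 1` the second lower argument is `-2 * i`, so only `i = 0` survives: all `d - 1`
letters behind the front one break a loop each. -/
lemma c_last {d n k : ℕ} (hd : 1 ≤ d) : c d n k (k + d - 1) = (k + d - 1).choose (d - 1) := by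
  rw [c, Finset.sum_eq_single_of_mem 0 (Finset.mem_range.mpr hd)]
  · rw [show ((k + d - 1 : ℕ) : ℤ) + (0 : ℕ) - k = (d - 1 : ℕ) by omega, binom_natCast,
      show (d : ℤ) - 2 * (0 : ℕ) - (k + d - 1 : ℕ) + k - 1 = 0 by omega]
    simp [binom]
  · intro i _ hi
    rw [binom_of_neg _ (by omega : (d : ℤ) - 2 * i - (k + d - 1 : ℕ) + k - 1 < 0), mul_zero]

lemma c_last_ne_zero {d n k : ℕ} (hd : 1 ≤ d) : c d n k (k + d - 1) ≠ 0 := by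
  rw [c_last hd, Nat.cast_ne_zero]
  exact (Nat.choose_pos (by omega)).ne'

/-- The recurrence solved for its last term. -/
lemma a_recurrence_last {d n : ℕ} (hd : 1 ≤ d) (hn : 1 ≤ n) (k : ℕ) :
    (a d ((n : ℤ) - 1) (k + d - 1) : ℚ) =
      ((a d n k : ℚ) - ∑ t ∈ Finset.Ico (k + 1 - d) (k + d - 1),
        (c d n k t : ℚ) * (a d ((n : ℤ) - 1) t : ℚ)) / (c d n k (k + d - 1) : ℚ) := by
  rw [eq_div_iff (Int.cast_ne_zero.mpr (c_last_ne_zero hd)), a_recurrence hd hn k,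
    ← Finset.Ico_insert_right (by omega), Finset.sum_insert (by simp)]
  ring

end Recurrence

/-! ### Splitting the diagrams by the number of cliques with loops. -/

section Spread

lemma Diagram.loopyCliques_le_loops {d n : ℕ} (D : Diagram d n) : D.loopyCliques ≤ D.loops := by
  rw [Diagram.loopyCliques, Finset.card_filter]
  refine Finset.sum_le_sum fun B _ => ?_
  split_ifs with h
  · exact Finset.card_pos.mpr h
  · exact Nat.zero_le _

lemma Diagram.loopyCliques_pos {d n : ℕ} (D : Diagram d n) (h : 1 ≤ D.loops) :
    1 ≤ D.loopyCliques := by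
  by_contra h0
  have h0 : D.loopyCliques = 0 := by omega
  rw [Diagram.loopyCliques, Finset.card_eq_zero, Finset.filter_eq_empty_iff] at h0
  have : D.loops = 0 := Finset.sum_eq_zero fun B hB => by
    simpa [Finset.not_nonempty_iff_eq_empty] using h0 hB
  omega

instance (d n : ℕ) : Finite (Diagram d n) := inferInstanceAs (Finite (Subtype _))

lemma a_eq_sum_aSpread (d n : ℕ) {k : ℕ} (hk : 1 ≤ k) :
    a d n k = ∑ l ∈ Finset.Icc 1 k, aSpread d n k l := by
  classical
  have := Fintype.ofFinite (Diagram d n)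
  rw [a, if_pos (by omega)]
  change Nat.card {D : Diagram d n // D.loops = k} = _
  simp only [aSpread, Nat.card_eq_fintype_card, Fintype.card_subtype]
  rw [Finset.card_eq_sum_card_fiberwise (f := Diagram.loopyCliques) (t := Finset.Icc 1 k)]
  · simp only [Finset.filter_filter]
  · intro D hD
    have hD : D.loops = k := by simpa using hD
    have := D.loopyCliques_le_loops
    have := D.loopyCliques_pos (by omega)
    simp only [Finset.coe_Icc, Set.mem_Icc]
    omega

end Spread

/-! ### Words with prescribed numbers of runs. -/

section Spread

lemma one_le_letterRuns {ι : Type*} [DecidableEq ι] {x : ι} {w : List ι} (h : 1 ≤ w.count x) :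
    1 ≤ letterRuns x w := by
  induction w with
  | nil => simp at h
  | cons y w ih =>
    simp only [letterRuns]
    by_cases hw : 1 ≤ w.count x
    · have := ih hw
      omega
    · have hx : x ∉ w := fun hx => hw (List.count_pos_iff.mpr hx)
      have hy : y = x := by
        by_contra hy
        rw [List.count_cons_of_ne hy] at h
        exact hw h
      rw [if_pos ⟨hy, fun hh => hx (List.mem_of_mem_head? hh)⟩]
      omega

/-- The letters `e i` of the word `w` form `r i` runs, and all other letters form no loops. -/
def HasRuns (d : ℕ) {n l : ℕ} (e : Fin l ↪ Fin n) (r : Fin l → ℕ) (w : List (Fin n)) : Prop :=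
  (∀ i, letterRuns (e i) w = r i) ∧ ∀ y ∉ Set.range e, letterRuns y w = d

/-- The words in which every letter of `Fin n` occurs `d` times. -/
def fullWords (d n : ℕ) : Finset (List (Fin n)) := words (d • (Finset.univ : Finset (Fin n)).val)

lemma mem_fullWords {d n : ℕ} {w : List (Fin n)} : w ∈ fullWords d n ↔ ∀ y, w.count y = d := by
  rw [fullWords, mem_words_nsmul]
  simp

variable {d n l : ℕ}

open Classical in
/-- The letter multiplicities after collapsing a word with the given runs. -/
def runContent (d : ℕ) (e : Fin l ↪ Fin n) (r : Fin l → ℕ) : Multiset (Fin n) :=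
  d • (Finset.univ \ Finset.univ.map e).val + content (List.ofFn fun i => (e i, r i))

lemma count_runContent (d : ℕ) (e : Fin l ↪ Fin n) (r : Fin l → ℕ) (y : Fin n) :
    (runContent d e r).count y =
      (if y ∈ Set.range e then 0 else d) + ∑ i, if e i = y then r i else 0 := by
  have hc : content (List.ofFn fun i => (e i, r i)) =
      ∑ i, Multiset.replicate (r i) (e i) := by
    rw [content, List.map_ofFn, List.sum_ofFn]
    rfl
  rw [runContent, hc, Multiset.count_add, Multiset.count_nsmul, Multiset.count_sum',
    Multiset.count_eq_of_nodup (Finset.nodup _)]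
  simp only [Multiset.count_replicate, Finset.mem_val, Finset.mem_sdiff, Finset.mem_univ,
    Finset.mem_map, true_and, Set.mem_range]
  congr 1
  split_ifs <;> simp_all

lemma count_runContent_apply (d : ℕ) (e : Fin l ↪ Fin n) (r : Fin l → ℕ) (i : Fin l) :
    (runContent d e r).count (e i) = r i := by
  rw [count_runContent, if_pos ⟨i, rfl⟩]
  simp [e.injective.eq_iff]

lemma count_runContent_of_notMem (d : ℕ) (e : Fin l ↪ Fin n) (r : Fin l → ℕ) {y : Fin n}
    (hy : y ∉ Set.range e) : (runContent d e r).count y = d := by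
  rw [count_runContent, if_neg hy]
  simp [show ∀ i, ¬ e i = y from fun i h => hy ⟨i, h⟩]

/-- Collapsing turns numbers of runs into multiplicities, by `count_collapse`. -/
lemma hasRuns_iff (e : Fin l ↪ Fin n) (r : Fin l → ℕ) (w : List (Fin n)) :
    HasRuns d e r w ↔ collapse w ∈ words (runContent d e r) := by
  rw [mem_words, Multiset.ext]
  simp only [Multiset.coe_count, count_collapse]
  constructor
  · rintro ⟨h1, h2⟩ y
    by_cases hy : y ∈ Set.range e
    · obtain ⟨i, rfl⟩ := hy
      rw [h1, count_runContent_apply]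
    · rw [h2 y hy, count_runContent_of_notMem d e r hy]
  · intro h
    exact ⟨fun i => by rw [h, count_runContent_apply],
      fun y hy => by rw [h, count_runContent_of_notMem d e r hy]⟩

lemma compositions_self (c : ℕ) : compositions c c = 1 := by
  cases c <;> simp [compositions]

open Classical in
/-- Words with prescribed runs, counted by collapsing the runs. -/
lemma card_hasRuns_eq (hd : 1 ≤ d) (e : Fin l ↪ Fin n) (r : Fin l → ℕ) (hr : ∀ i, 1 ≤ r i) :
    ((fullWords d n).filter fun w => HasRuns d e r w).card =
      alpha d r * ((words (runContent d e r)).filter fun u => wordLoops u = 0).card := by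
  rw [Finset.card_eq_sum_card_fiberwise (f := collapse)
    (t := (words (runContent d e r)).filter fun u => wordLoops u = 0)]
  · rw [mul_comm, ← smul_eq_mul, ← Finset.sum_const]
    refine Finset.sum_congr rfl fun u hu => ?_
    rw [Finset.mem_filter] at hu
    rw [Finset.filter_filter, Finset.filter_congr (q := fun w => collapse w = u)
      (fun w _ => ⟨fun h => h.2, fun h => ⟨(hasRuns_iff e r w).mpr (h ▸ hu.1), h⟩⟩),
      fullWords, card_collapse_eq _ u hu.2]
    have hcount : ∀ y, u.count y = (runContent d e r).count y := fun y => by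
      rw [← Multiset.coe_count, mem_words.mp hu.1]
    -- Only the listed letters matter: an unlisted letter has `d` runs, and `d` has one composition
    -- into `d` parts.
    rw [← Finset.prod_subset (Finset.subset_univ (Finset.univ.map e)), Finset.prod_map, alpha]
    · refine Finset.prod_congr rfl fun i _ => ?_
      rw [hcount, count_runContent_apply, Multiset.count_nsmul,
        Multiset.count_eq_one_of_mem (Finset.nodup _) (Finset.mem_univ _)]
      obtain ⟨c, rfl⟩ := Nat.exists_eq_add_of_le' hd
      obtain ⟨t, ht⟩ := Nat.exists_eq_add_of_le' (hr i)
      rw [ht]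
      simp [compositions]
    · intro y _ hy
      rw [hcount, count_runContent_of_notMem d e r (by simpa using hy), Multiset.count_nsmul,
        Multiset.count_eq_one_of_mem (Finset.nodup _) (Finset.mem_univ _), mul_one,
        compositions_self]
  · intro w hw
    rw [Finset.mem_coe, Finset.mem_filter] at hw ⊢
    exact ⟨(hasRuns_iff e r w).mp hw.2, wordLoops_collapse w⟩

/-- The number of words with prescribed runs, up to labelling of the remaining cliques. -/
lemma card_hasRuns (hd : 1 ≤ d) (hl : 1 ≤ l) (e : Fin l ↪ Fin n) (r : Fin l → ℕ)
    (hr : ∀ i, 1 ≤ r i) [DecidablePred (HasRuns d e r)] :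
    (((fullWords d n).filter fun w => HasRuns d e r w).card : ℚ) =
      (n - l).factorial * ((alpha d r : ℚ) * ∑ m ∈ Finset.range (∑ i, r i + 1),
        (p d n r m : ℚ) * a d ((n : ℤ) - l) m) := by
  classical
  have hln : l ≤ n := by simpa using Fintype.card_le_of_embedding e
  have hT : (Finset.univ \ Finset.univ.map e).card = n - l := by
    rw [Finset.card_sdiff_of_subset (Finset.subset_univ _)]
    simp
  have hcast : (n : ℤ) - l = ((n - l : ℕ) : ℤ) := by omega
  have h := card_words_loopless (List.ofFn fun i => (e i, r i))
    (by rw [Ne, List.ofFn_eq_nil_iff]; omega)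
    (by
      rw [List.map_ofFn]
      exact List.nodup_ofFn.mpr e.injective)
    (by
      intro q hq
      obtain ⟨i, rfl⟩ := List.mem_ofFn.mp hq
      exact hr i)
    (d • (Finset.univ \ Finset.univ.map e).val)
    (by
      intro q hq
      obtain ⟨i, rfl⟩ := List.mem_ofFn.mp hq
      intro h
      exact (Finset.mem_sdiff.mp (Finset.mem_val.mp (Multiset.mem_of_mem_nsmul h))).2 (by simp))
  have hp : ∀ m, pNested (((d • (Finset.univ \ Finset.univ.map e).val).card : ℤ) + 1) m
      ((List.ofFn fun i => (e i, r i)).map Prod.snd) = p d n r m := by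
    intro m
    rw [Multiset.card_nsmul, Finset.card_val, hT, p, hcast, List.map_ofFn]
    push_cast
    rfl
  simp only [hp] at h
  have hQ : (((words (runContent d e r)).filter fun u => wordLoops u = 0).card : ℚ) =
      ∑ w ∈ words (d • (Finset.univ \ Finset.univ.map e).val), (p d n r (wordLoops w) : ℚ) := by
    rw [runContent]
    exact_mod_cast h
  rw [sum_words_wordLoops hd hT (Finset.range (∑ i, r i + 1)) fun m => (p d n r m : ℚ)] at hQ
  · have h' := card_hasRuns_eq hd e r hr
    have h'' : (((fullWords d n).filter fun w => HasRuns d e r w).card : ℚ) = (alpha d r *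
      ((words (runContent d e r)).filter fun u => wordLoops u = 0).card : ℕ) := by
      rw [← h']
      congr!
    rw [h'', Nat.cast_mul, hQ, hcast]
    ring
  · intro m hm
    rw [Finset.mem_range] at hm
    rw [p, pNested_of_sum_lt _ _ _ (by rw [List.sum_ofFn]; omega), Int.cast_zero]

lemma HasRuns.range_eq {e : Fin l ↪ Fin n} {r : Fin l → ℕ} {w : List (Fin n)}
    (h : HasRuns d e r w) (hr : ∀ i, r i < d) : Set.range e = {y | letterRuns y w < d} := by
  ext y
  constructor
  · rintro ⟨i, rfl⟩
    rw [Set.mem_ofPred_eq, h.1]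
    exact hr i
  · intro hy
    by_contra hy'
    exact absurd (h.2 y hy') (ne_of_lt hy)

/-- Both listings enumerate the letters with fewer than `d` runs, a set that depends on `w` only. -/
lemma HasRuns.exists_perm {e e' : Fin l ↪ Fin n} {r r' : Fin l → ℕ} {w : List (Fin n)}
    (h : HasRuns d e r w) (h' : HasRuns d e' r' w) (hr : ∀ i, r i < d) (hr' : ∀ i, r' i < d) :
    ∃ σ : Equiv.Perm (Fin l), (∀ i, e' i = e (σ i)) ∧ r' = r ∘ σ := by
  have hmem : ∀ i, ∃ j, e j = e' i := fun i => by
    have : e' i ∈ Set.range e' := ⟨i, rfl⟩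
    rwa [h'.range_eq hr', ← h.range_eq hr] at this
  choose s hs using hmem
  have hinj : Function.Injective s := fun i j hij => e'.injective (by rw [← hs, ← hs, hij])
  refine ⟨Equiv.ofBijective s (Finite.injective_iff_bijective.mp hinj), fun i => (hs i).symm, ?_⟩
  funext i
  rw [← h'.1 i, ← hs i, h.1]
  rfl

lemma HasRuns.comp_perm {e : Fin l ↪ Fin n} {r : Fin l → ℕ} {w : List (Fin n)}
    (h : HasRuns d e r w) (σ : Equiv.Perm (Fin l)) :
    HasRuns d (σ.toEmbedding.trans e) (r ∘ σ) w := by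
  refine ⟨fun i => h.1 (σ i), fun y hy => h.2 y fun hy' => hy ?_⟩
  obtain ⟨i, rfl⟩ := hy'
  exact ⟨σ.symm i, by simp⟩

open Classical in
/-- The number of ways to list the cliques with loops so that their runs form the list `r`. -/
lemma card_embeddings {e : Fin l ↪ Fin n} {r : Fin l → ℕ} {w : List (Fin n)}
    (h : HasRuns d e r w) (hr : ∀ i, 1 ≤ r i ∧ r i < d) :
    (Finset.univ.filter fun e' : Fin l ↪ Fin n => HasRuns d e' r w).card =
      ∏ u ∈ Finset.Icc 1 (d - 1), (beta r u).factorial := by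
  -- The listings of the loopy letters of `w` with the same `r` differ from `e` by the permutations
  -- that fix `r`, a group of order `∏ β_u!`.
  let F : {σ : Equiv.Perm (Fin l) // r ∘ σ = r} →
      (Finset.univ.filter fun e' : Fin l ↪ Fin n => HasRuns d e' r w : Finset (Fin l ↪ Fin n)) :=
    fun σ => ⟨σ.1.toEmbedding.trans e, by
      have := h.comp_perm σ.1
      rw [σ.2] at this
      simpa using this⟩
  have hF : Function.Bijective F := by
    constructor
    · rintro σ τ hστ
      apply Subtype.ext
      apply Equiv.ext
      intro i
      have := DFunLike.congr_fun (congrArg Subtype.val hστ) i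
      exact e.injective this
    · rintro ⟨e', he'⟩
      obtain ⟨σ, h1, h2⟩ := h.exists_perm (Finset.mem_filter.mp he').2
        (fun i => (hr i).2) (fun i => (hr i).2)
      refine ⟨⟨σ, h2.symm⟩, Subtype.ext ?_⟩
      ext i
      simp [F, h1]
  rw [← Nat.card_eq_finsetCard, ← Nat.card_congr (Equiv.ofBijective F hF),
    Nat.card_eq_fintype_card, DomMulAct.stabilizer_card']
  refine Eq.trans (Finset.prod_congr rfl fun u _ => ?_)
    (Finset.prod_subset (s₁ := Finset.univ.image r) ?_ ?_)
  · rw [beta, Fintype.card_subtype]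
  · intro u hu
    obtain ⟨i, -, rfl⟩ := Finset.mem_image.mp hu
    have := hr i
    rw [Finset.mem_Icc]
    omega
  · intro u _ hu
    rw [beta, Finset.card_eq_zero.mpr, Nat.factorial_zero]
    rw [Finset.filter_eq_empty_iff]
    rintro i - rfl
    exact hu (Finset.mem_image_of_mem _ (Finset.mem_univ i))

lemma mem_multisets {k : ℕ} {r : Fin l → ℕ} : r ∈ multisets d k l ↔
    (∀ i, 1 ≤ r i ∧ r i ≤ d - 1) ∧ Monotone r ∧ ∑ i, (d - r i) = k := by
  simp [multisets, Fintype.mem_piFinset]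

open Classical in
/-- The loops of a word lie in `l` of its letters exactly when these letters have prescribed runs. -/
lemma filter_spread_eq (hd : 1 ≤ d) (k : ℕ) :
    ((fullWords d n).filter fun w =>
      wordLoops w = k ∧ (Finset.univ.filter fun x => letterLoops x w ≠ 0).card = l) =
      (multisets d k l).biUnion fun r =>
        (fullWords d n).filter fun w => ∃ e : Fin l ↪ Fin n, HasRuns d e r w := by
  ext w
  simp only [Finset.mem_filter, Finset.mem_biUnion, mem_multisets]
  constructor
  · rintro ⟨hw, h1, h2⟩
    have hcount := mem_fullWords.mp hw
    have hrl : ∀ y, letterRuns y w + letterLoops y w = d := fun y => by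
      rw [letterRuns_add_letterLoops, hcount]
    -- An arbitrary listing of the letters with loops; sorting by the number of runs then makes `r`
    -- monotone.
    let e₀ : Fin l ↪ Fin n := (Finset.equivFinOfCardEq h2).symm.toEmbedding.trans
      (Function.Embedding.subtype _)
    have he₀ : ∀ i, letterLoops (e₀ i) w ≠ 0 := fun i =>
      (Finset.mem_filter.mp ((Finset.equivFinOfCardEq h2).symm i).2).2
    have hrange : ∀ y ∉ Set.range e₀, letterLoops y w = 0 := by
      intro y hy
      by_contra h
      refine hy ⟨Finset.equivFinOfCardEq h2 ⟨y, by simpa using h⟩, ?_⟩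
      simp [e₀]
    have h₀ : HasRuns d e₀ (fun i => letterRuns (e₀ i) w) w :=
      ⟨fun _ => rfl, fun y hy => by have := hrl y; have := hrange y hy; omega⟩
    refine ⟨_, ⟨fun i => ?_, Tuple.monotone_sort _, ?_⟩, hw, _, h₀.comp_perm (Tuple.sort _)⟩
    · have := hrl (e₀ (Tuple.sort (fun i => letterRuns (e₀ i) w) i))
      have := he₀ (Tuple.sort (fun i => letterRuns (e₀ i) w) i)
      have := one_le_letterRuns (x := e₀ (Tuple.sort (fun i => letterRuns (e₀ i) w) i)) (w := w)
        (by rw [hcount]; exact hd)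
      simp only [Function.comp_apply]
      omega
    · simp only [Function.comp_apply]
      rw [Equiv.sum_comp (Tuple.sort fun i => letterRuns (e₀ i) w)
        (fun i => d - letterRuns (e₀ i) w), ← h1,
        ← sum_letterLoops Finset.univ w (fun _ _ => Finset.mem_univ _),
        ← Finset.sum_subset (Finset.subset_univ (Finset.univ.map e₀)), Finset.sum_map]
      · refine Finset.sum_congr rfl fun i _ => ?_
        have := hrl (e₀ i)
        omega
      · intro y _ hy
        exact hrange y (by simpa using hy)
  · rintro ⟨r, ⟨hr, -, hk⟩, hw, e, he⟩
    have hcount := mem_fullWords.mp hw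
    have hrl : ∀ y, letterRuns y w + letterLoops y w = d := fun y => by
      rw [letterRuns_add_letterLoops, hcount]
    have hzero : ∀ y ∉ Set.range e, letterLoops y w = 0 := fun y hy => by
      have := hrl y
      have := he.2 y hy
      omega
    refine ⟨hw, ?_, ?_⟩
    · rw [← hk, ← sum_letterLoops Finset.univ w (fun _ _ => Finset.mem_univ _),
        ← Finset.sum_subset (Finset.subset_univ (Finset.univ.map e)), Finset.sum_map]
      · refine Finset.sum_congr rfl fun i _ => ?_
        have := hrl (e i)
        have := he.1 i
        omega
      · intro y _ hy
        exact hzero y (by simpa using hy)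
    · rw [show (Finset.univ.filter fun x => letterLoops x w ≠ 0) = Finset.univ.map e from ?_]
      · simp
      · ext y
        simp only [Finset.mem_filter, Finset.mem_univ, true_and, Finset.mem_map]
        constructor
        · intro hy
          by_contra hy'
          exact hy (hzero y (by simpa using hy'))
        · rintro ⟨i, rfl⟩
          have := hrl (e i)
          have := he.1 i
          have := hr i
          omega

/-- The formula for the diagrams whose `k` loops are spread over `l ≥ 1` cliques. -/
lemma aSpread_eq (hd : 1 ≤ d) (hl : 1 ≤ l) (n k : ℕ) :
    (aSpread d n k l : ℚ) = ∑ r ∈ multisets d k l,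
      (alpha d r : ℚ) / (∏ u ∈ Finset.Icc 1 (d - 1), (Nat.factorial (beta r u) : ℚ)) *
        ∑ m ∈ Finset.range (l * d - k + 1), (p d n r m : ℚ) * (a d ((n : ℤ) - l) m : ℚ) := by
  classical
  have hn : (n.factorial : ℚ) ≠ 0 := Nat.cast_ne_zero.mpr n.factorial_ne_zero
  have key : ∀ r ∈ multisets d k l,
      (((fullWords d n).filter fun w => ∃ e : Fin l ↪ Fin n, HasRuns d e r w).card : ℚ) =
      n.factorial * ((alpha d r : ℚ) /
        (∏ u ∈ Finset.Icc 1 (d - 1), (Nat.factorial (beta r u) : ℚ)) *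
        ∑ m ∈ Finset.range (l * d - k + 1), (p d n r m : ℚ) * (a d ((n : ℤ) - l) m : ℚ)) := by
    intro r hr
    obtain ⟨hr, -, hk⟩ := mem_multisets.mp hr
    have hr' : ∀ i, 1 ≤ r i ∧ r i < d := fun i => ⟨(hr i).1, by have := hr i; omega⟩
    have hsum : l * d - k = ∑ i, r i := by
      have : k + ∑ i, r i = l * d := by
        rw [← hk, ← Finset.sum_add_distrib,
          Finset.sum_congr rfl (g := fun _ => d) fun i _ => by have := hr' i; omega]
        simp
      omega
    have hB : (∏ u ∈ Finset.Icc 1 (d - 1), (Nat.factorial (beta r u) : ℚ)) ≠ 0 :=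
      Finset.prod_ne_zero_iff.mpr fun u _ => Nat.cast_ne_zero.mpr (Nat.factorial_ne_zero _)
    -- Double count of the pairs `(e, w)`: each of the `n! / (n - l)!` listings has the same number
    -- of words, and each word occurs with `∏ β_u!` listings.
    have hdouble := Finset.sum_card_bipartiteAbove_eq_sum_card_bipartiteBelow
      (s := (Finset.univ : Finset (Fin l ↪ Fin n))) (t := fullWords d n)
      (fun e w => HasRuns d e r w)
    simp only [Finset.bipartiteAbove, Finset.bipartiteBelow] at hdouble
    have hright : ∑ w ∈ fullWords d n,
        (Finset.univ.filter fun e : Fin l ↪ Fin n => HasRuns d e r w).card =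
        ((fullWords d n).filter fun w => ∃ e : Fin l ↪ Fin n, HasRuns d e r w).card *
          ∏ u ∈ Finset.Icc 1 (d - 1), (beta r u).factorial := by
      rw [← smul_eq_mul, ← Finset.sum_const, Finset.sum_filter]
      refine Finset.sum_congr rfl fun w _ => ?_
      split_ifs with h
      · obtain ⟨e, he⟩ := h
        exact card_embeddings he hr'
      · rw [Finset.card_eq_zero, Finset.filter_eq_empty_iff]
        exact fun e _ he => h ⟨e, he⟩
    rw [hright] at hdouble
    have hQ := congrArg (Nat.cast (R := ℚ)) hdouble
    rw [Nat.cast_sum, Finset.sum_congr rfl fun e _ => card_hasRuns hd hl e r fun i => (hr i).1,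
      Finset.sum_const, Finset.card_univ, Fintype.card_embedding_eq, Fintype.card_fin,
      Fintype.card_fin, nsmul_eq_mul, Nat.cast_mul, Nat.cast_prod, ← hsum] at hQ
    rw [eq_comm, div_mul_eq_mul_div, ← mul_div_assoc, div_eq_iff hB, ← hQ]
    -- For `l > n` there is no listing, and the other side vanishes since `a` is zero at `n - l <
    -- 0`.
    by_cases hln : l ≤ n
    · rw [← Nat.factorial_mul_descFactorial hln]
      push_cast
      ring
    · rw [Nat.descFactorial_eq_zero_iff_lt.mpr (by omega), Finset.sum_eq_zero]
      · simp
      · intro m _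
        rw [a, if_neg (by omega)]
        simp
  refine mul_left_cancel₀ hn ?_
  rw [← Nat.cast_mul, ← card_words_spread hd (T := (Finset.univ : Finset (Fin n))) (by simp) k l,
    ← fullWords, filter_spread_eq hd k, Finset.card_biUnion, Nat.cast_sum,
    Finset.sum_congr rfl key, Finset.mul_sum]
  intro r hr r' hr' hne
  rw [Function.onFun, Finset.disjoint_filter]
  rintro w - ⟨e, he⟩ ⟨e', he'⟩
  rw [Finset.mem_coe, mem_multisets] at hr hr'
  obtain ⟨σ, -, hσ⟩ := he.exists_perm he'
    (fun i => by have := hr.1 i; omega) (fun i => by have := hr'.1 i; omega)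
  -- The classes of different `r` are disjoint: two monotone rearrangements of one list coincide.
  have h1 := Tuple.comp_sort_eq_comp_iff_monotone.mpr (hσ ▸ hr'.2.1)
  have h2 := (Tuple.comp_sort_eq_comp_iff_monotone (f := r) (σ := Equiv.refl _)).mpr hr.2.1
  rw [← hσ, ← h2] at h1
  exact hne h1.symm

lemma multisets_one {k : ℕ} (hk : 1 ≤ k) (hkd : k ≤ d - 1) :
    multisets d k 1 = {fun _ => d - k} := by
  ext r
  rw [mem_multisets, Finset.mem_singleton]
  constructor
  · rintro ⟨h1, -, h3⟩
    funext i
    obtain rfl : i = 0 := Subsingleton.elim _ _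
    have := h1 0
    rw [Fin.sum_univ_one] at h3
    omega
  · rintro rfl
    refine ⟨fun _ => by dsimp only; omega, monotone_const, ?_⟩
    rw [Fin.sum_univ_one]
    dsimp only
    omega

/-- The formula for the diagrams whose `k` loops lie in a single clique. -/
lemma aSpread_one (hd : 1 ≤ d) (n : ℕ) {k : ℕ} (hk : 1 ≤ k) (hkd : k ≤ d - 1) :
    (aSpread d n k 1 : ℚ) = ((d - 1).choose k : ℚ) * ∑ m ∈ Finset.range (d - k + 1),
      (binom (d * ((n : ℤ) - 1) + 1 - m) ((d : ℤ) - k - m) : ℚ) *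
        (a d ((n : ℤ) - 1) m : ℚ) := by
  rw [aSpread_eq hd le_rfl, multisets_one hk hkd, Finset.sum_singleton, one_mul]
  congr 1
  · rw [alpha, Fin.prod_univ_one, Finset.prod_eq_one, div_one]
    · rw [show d - k - 1 = d - 1 - k by omega, Nat.choose_symm hkd]
    · intro u _
      rw [beta]
      by_cases h : d - k = u <;> simp [h]
  · refine Finset.sum_congr rfl fun m _ => ?_
    have : ((d - k : ℕ) : ℤ) = (d : ℤ) - k := by omega
    simp [p, pNested, this]

end Spread

/-! ### Elimination of the large indices and the closed system. -/

section ClosedSystem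

variable {d : ℕ}

lemma elim_of_lt (x : ℤ → ℕ → ℚ) (n : ℤ) {m : ℕ} (h : m < d) : elim d x n m = x n m := by
  rw [elim, if_pos h]

lemma elim_of_le (x : ℤ → ℕ → ℚ) {n : ℤ} {m : ℕ} (h : d ≤ m) (hn : 0 ≤ n) (hd : 2 ≤ d) :
    elim d x n m = (elim d x (n + 1) (m + 1 - d) -
      ∑ t ∈ Finset.Ico (m + 2 - 2 * d) m, (c d (n + 1) (m + 1 - d) t : ℚ) * elim d x n t) /
        (c d (n + 1) (m + 1 - d) m : ℚ) := by
  rw [elim, if_neg (by omega), dif_neg (by omega),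
    Finset.sum_attach _ fun t => (c d (n + 1) (m + 1 - d) t : ℚ) * elim d x n t]

lemma elim_eq_zero (x : ℤ → ℕ → ℚ) {n : ℤ} {m : ℕ} (h : d ≤ m) (hn : n < 0 ∨ d < 2) :
    elim d x n m = 0 := by
  rw [elim, if_neg (by omega), dif_pos hn]

lemma a_of_neg {n : ℤ} (hn : n < 0) (k : ℕ) : a d n k = 0 := by
  rw [a, if_neg (by omega)]

lemma a_zero (k : ℕ) : a d 0 k = if k = 0 then 1 else 0 := by
  have hloops : ∀ D : Diagram d 0, D.loops = 0 := by
    intro D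
    refine Finset.sum_eq_zero fun B _ => Finset.card_eq_zero.mpr ?_
    exact Finset.eq_empty_of_forall_notMem fun i => (Fin.cast (mul_zero d) i).elim0
  rw [a, if_pos le_rfl]
  change Nat.card {D : Diagram d 0 // D.loops = k} = _
  simp only [hloops]
  split_ifs with hk
  · subst hk
    have huniv : (Finset.univ : Finset (Fin (d * 0))) = ⊥ :=
      Finset.eq_empty_of_forall_notMem fun i => (Fin.cast (mul_zero d) i).elim0
    have hsub : Subsingleton (Finpartition (Finset.univ : Finset (Fin (d * 0)))) := by
      rw [huniv]
      infer_instance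
    have hne : Nonempty (Finpartition (Finset.univ : Finset (Fin (d * 0)))) := inferInstance
    obtain ⟨P⟩ := hne
    rw [Nat.card_eq_one_iff_unique]
    refine ⟨⟨fun D D' => Subtype.ext (Subtype.ext (Subsingleton.elim _ _))⟩,
      ⟨⟨⟨P, fun B hB => ?_⟩, rfl⟩⟩⟩
    obtain ⟨i, -⟩ := P.nonempty_of_mem_parts hB
    exact (Fin.cast (mul_zero d) i).elim0
  · rw [Nat.card_eq_zero]
    exact Or.inl ⟨fun D => hk D.2.symm⟩

/-- This justifies the default value in `elim`: for `d = 1` the solved recurrence does not lower the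
index `m`. -/
lemma a_one_eq_zero (n : ℤ) {k : ℕ} (hk : 1 ≤ k) : a 1 n k = 0 := by
  by_cases hn : 0 ≤ n
  · lift n to ℕ using hn
    induction n with
    | zero => rw [Nat.cast_zero, a_zero, if_neg (by omega)]
    | succ n ih =>
      have h := a_recurrence (d := 1) (n := n + 1) le_rfl (by omega) k
      rw [show k + 1 - 1 = k by omega, Finset.Icc_self, Finset.sum_singleton,
        show ((n + 1 : ℕ) : ℤ) - 1 = n by omega, ih, Nat.cast_zero, mul_zero] at h
      exact_mod_cast h
  · exact a_of_neg (by omega) k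

/-- The recursion of `elim` is the solved recurrence in row `n + 1` at `k = m + 1 - d`, and its
default values are true values of `a`. -/
lemma elim_a (hd : 1 ≤ d) (n : ℤ) (m : ℕ) :
    elim d (fun i j => (a d i j : ℚ)) n m = (a d n m : ℚ) := by
  induction m using Nat.strong_induction_on generalizing n with
  | _ m ih =>
    by_cases hm : m < d
    · rw [elim_of_lt _ _ hm]
    · by_cases hn : n < 0 ∨ d < 2
      · rw [elim_eq_zero _ (by omega) hn]
        rcases hn with hn | hn
        · rw [a_of_neg hn, Nat.cast_zero]
        · obtain rfl : d = 1 := by omega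
          rw [a_one_eq_zero _ (by omega), Nat.cast_zero]
      · rw [elim_of_le _ (by omega) (by omega) (by omega), ih (m + 1 - d) (by omega),
          Finset.sum_congr rfl fun t ht => by rw [ih t (Finset.mem_Ico.mp ht).2]]
        lift n to ℕ using by omega
        have h := a_recurrence_last (n := n + 1) hd (by omega) (m + 1 - d)
        rw [show m + 1 - d + 1 - d = m + 2 - 2 * d by omega,
          show m + 1 - d + d - 1 = m by omega] at h
        push_cast at h
        rw [add_sub_cancel_right] at h
        exact h.symm

/-- The rows that occur in the expression of an eliminated unknown. -/
lemma elim_congr (x y : ℤ → ℕ → ℚ) (n : ℤ) (l : ℕ)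
    (h : ∀ i : ℕ, 1 ≤ i → i ≤ l → ∀ t < d, x (n - i) t = y (n - i) t)
    {i : ℕ} (hi : 1 ≤ i) (hil : i ≤ l) {m : ℕ} (hm : m ≤ i * (d - 1)) :
    elim d x (n - i) m = elim d y (n - i) m := by
  induction m using Nat.strong_induction_on generalizing i with
  | _ m ih =>
    by_cases hmd : m < d
    · rw [elim_of_lt _ _ hmd, elim_of_lt _ _ hmd, h i hi hil m hmd]
    · by_cases hn : n - i < 0 ∨ d < 2
      · rw [elim_eq_zero _ (by omega) hn, elim_eq_zero _ (by omega) hn]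
      -- The recursion moves to row `n - j` with index `m - (d - 1) ≤ j * (d - 1)`. Since `m ≥ d`
      -- excludes `j = 0`, it never reaches row `n`.
      · obtain ⟨j, rfl⟩ := Nat.exists_eq_add_of_le' hi
        have hj : 1 ≤ j := by
          by_contra hj
          obtain rfl : j = 0 := by omega
          rw [zero_add, one_mul] at hm
          omega
        have hrow : n - ((j + 1 : ℕ) : ℤ) + 1 = n - j := by push_cast; ring
        rw [elim_of_le x (by omega) (by omega) (by omega),
          elim_of_le y (by omega) (by omega) (by omega), hrow,
          ih (m + 1 - d) (by omega) hj (by omega) (by rw [add_mul, one_mul] at hm; omega),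
          Finset.sum_congr rfl fun t ht => by
            rw [ih t (Finset.mem_Ico.mp ht).2 hi hil
              ((Finset.mem_Ico.mp ht).2.le.trans hm)]]

lemma elim_congr_last (x y : ℤ → ℕ → ℚ) (n : ℤ) {k l : ℕ} (hl : 1 ≤ l) (hlk : l ≤ k)
    (h : ∀ i : ℕ, 1 ≤ i → i ≤ l → ∀ t < d, x (n - i) t = y (n - i) t)
    {m : ℕ} (hm : m ≤ l * d - k) : elim d x (n - l) m = elim d y (n - l) m := by
  -- The bound holds as `l * d - k ≤ l * (d - 1)`, which uses `l ≤ k`.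
  refine elim_congr x y n l h hl le_rfl (hm.trans ?_)
  rw [Nat.mul_sub_one]
  omega

lemma a_recurrence_zero (hd : 1 ≤ d) {n : ℕ} (hn : 1 ≤ n) :
    (a d n 0 : ℚ) = ∑ t ∈ Finset.range d, (c d n 0 t : ℚ) * (a d ((n : ℤ) - 1) t : ℚ) := by
  rw [a_recurrence hd hn 0]
  refine Finset.sum_congr ?_ fun _ _ => rfl
  ext t
  rw [Finset.mem_Icc, Finset.mem_range]
  omega

lemma isClosedSystemSolution_a (hd : 1 ≤ d) :
    IsClosedSystemSolution d (fun i j => (a d i j : ℚ)) where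
  neg n hn k _ := by rw [a_of_neg hn, Nat.cast_zero]
  init_zero := by simp [a_zero]
  init_pos k hk _ := by rw [a_zero, if_neg (by omega), Nat.cast_zero]
  rec_zero n hn := by
    lift n to ℕ using by omega
    exact a_recurrence_zero hd (by omega)
  rec_pos n hn k hk hkd := by
    lift n to ℕ using by omega
    rw [a_eq_sum_aSpread d n hk, Nat.cast_sum, ← Finset.Ioc_insert_left hk,
      Finset.sum_insert (by simp), aSpread_one hd n hk (by omega), oneCliqueSum]
    congr 1
    refine Finset.sum_congr (by ext; simp [Nat.succ_le_iff]) fun l hl => ?_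
    rw [Finset.mem_Icc] at hl
    rw [aSpread_eq hd (by omega), manyCliquesSum]
    simp only [elim_a hd]

/-- Induction on the row: by `elim_congr_last`, even the eliminated terms on the right-hand sides
involve earlier rows only. -/
lemma IsClosedSystemSolution.eq_of_forall_lt {x y : ℤ → ℕ → ℚ} (hx : IsClosedSystemSolution d x)
    (hy : IsClosedSystemSolution d y) (n : ℤ) (k : ℕ) (hk : k < d) : x n k = y n k := by
  by_cases hn : n < 0
  · rw [hx.neg n hn k hk, hy.neg n hn k hk]
  lift n to ℕ using by omega
  induction n using Nat.strong_induction_on generalizing k with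
  | _ n ih =>
    have hrows : ∀ i : ℕ, 1 ≤ i → ∀ t < d, x ((n : ℤ) - i) t = y ((n : ℤ) - i) t := by
      intro i hi t ht
      by_cases hin : i ≤ n
      · have := ih (n - i) (by omega) t ht (by omega)
        rwa [Nat.cast_sub hin] at this
      · rw [hx.neg _ (by omega) t ht, hy.neg _ (by omega) t ht]
    have hrow : ∀ t < d, x ((n : ℤ) - 1) t = y ((n : ℤ) - 1) t :=
      fun t ht => by simpa using hrows 1 le_rfl t ht
    by_cases hn0 : n = 0
    · subst hn0
      by_cases hk0 : k = 0
      · subst hk0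
        exact hx.init_zero.trans hy.init_zero.symm
      · exact (hx.init_pos k (by omega) hk).trans (hy.init_pos k (by omega) hk).symm
    · by_cases hk0 : k = 0
      · subst hk0
        rw [hx.rec_zero n (by omega), hy.rec_zero n (by omega)]
        exact Finset.sum_congr rfl fun t ht => by rw [hrow t (Finset.mem_range.mp ht)]
      · rw [hx.rec_pos n (by omega) k (by omega) hk, hy.rec_pos n (by omega) k (by omega) hk,
          oneCliqueSum, oneCliqueSum]
        congr 1
        · congr 1
          refine Finset.sum_congr rfl fun m hm => ?_
          rw [Finset.mem_range] at hm
          rw [hrow m (by omega)]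
        · refine Finset.sum_congr rfl fun l hl => Finset.sum_congr rfl fun r _ => ?_
          rw [Finset.mem_Icc] at hl
          congr 1
          refine Finset.sum_congr rfl fun m hm => ?_
          rw [Finset.mem_range] at hm
          rw [elim_congr_last x y n (by omega) hl.2 (fun i hi _ => hrows i hi) (by omega)]

end ClosedSystem

end LinearDiagram

open LinearDiagram in
theorem mainTheorem3 (d : ℕ) (hd : 1 ≤ d) :
    -- all `k` loops lie in one clique
    (∀ n k : ℕ, 1 ≤ k → k ≤ d - 1 →
      (aSpread d n k 1 : ℚ) =
        ((d - 1).choose k : ℚ) *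
          ∑ m ∈ Finset.range (d - k + 1),
            (binom (d * ((n : ℤ) - 1) + 1 - m) ((d : ℤ) - k - m) : ℚ) * (a d ((n : ℤ) - 1) m : ℚ)) ∧
    -- the `k` loops are spread over `l > 1` cliques
    (∀ n k l : ℕ, 1 ≤ k → k ≤ d - 1 → 1 < l → l ≤ k →
      (aSpread d n k l : ℚ) =
        ∑ r ∈ multisets d k l,
          (alpha d r : ℚ) / (∏ u ∈ Finset.Icc 1 (d - 1), (Nat.factorial (beta r u) : ℚ)) *
            ∑ m ∈ Finset.range (l * d - k + 1), (p d n r m : ℚ) * (a d ((n : ℤ) - l) m : ℚ)) ∧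
    -- these cases exhaust all diagrams with `k` loops
    (∀ n k : ℕ, 1 ≤ k → k ≤ d - 1 → a d n k = ∑ l ∈ Finset.Icc 1 k, aSpread d n k l) ∧
    -- the general recurrence, and its case `k = 0`
    (∀ n k : ℕ, 1 ≤ n →
      (a d n k : ℚ) =
        ∑ t ∈ Finset.Icc (k + 1 - d) (k + d - 1), (c d n k t : ℚ) * (a d ((n : ℤ) - 1) t : ℚ)) ∧
    (∀ n : ℕ, 1 ≤ n →
      (a d n 0 : ℚ) = ∑ t ∈ Finset.range d, (c d n 0 t : ℚ) * (a d ((n : ℤ) - 1) t : ℚ)) ∧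
    -- the general recurrence solved for its last term
    (∀ n k : ℕ, 1 ≤ n →
      c d n k (k + d - 1) ≠ 0 ∧
      (a d ((n : ℤ) - 1) (k + d - 1) : ℚ) =
        ((a d n k : ℚ) -
            ∑ t ∈ Finset.Ico (k + 1 - d) (k + d - 1),
              (c d n k t : ℚ) * (a d ((n : ℤ) - 1) t : ℚ)) /
          (c d n k (k + d - 1) : ℚ)) ∧
    -- repeated elimination recovers all `a_{n,m}` from the `a_{n,k}` with `k < d`
    (∀ (n : ℤ) (m : ℕ), elim d (fun i j => (a d i j : ℚ)) n m = (a d n m : ℚ)) ∧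
    -- the eliminated terms only involve the rows `n - 1, …, n - l` and the indices `0, …, d - 1`
    (∀ (x y : ℤ → ℕ → ℚ) (n : ℤ) (k l : ℕ), 1 ≤ k → k ≤ d - 1 → 1 < l → l ≤ k →
      (∀ i : ℕ, 1 ≤ i → i ≤ l → ∀ t < d, x (n - i) t = y (n - i) t) →
      ∀ m ≤ l * d - k, elim d x (n - l) m = elim d y (n - l) m) ∧
    -- the closed system holds for `a_{n,k}`, `k < d`, and determines these numbers
    IsClosedSystemSolution d (fun i j => (a d i j : ℚ)) ∧
    (∀ x : ℤ → ℕ → ℚ, IsClosedSystemSolution d x →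
      ∀ (n : ℤ) (k : ℕ), k < d → x n k = (a d n k : ℚ)) := by
  refine ⟨fun n k hk hkd => aSpread_one hd n hk hkd,
    fun n k l _ _ hl _ => aSpread_eq hd hl.le n k,
    fun n k hk _ => a_eq_sum_aSpread d n hk,
    fun n k hn => a_recurrence hd hn k,
    fun n hn => a_recurrence_zero hd hn,
    fun n k hn => ⟨c_last_ne_zero hd, a_recurrence_last hd hn k⟩,
    elim_a hd,
    fun x y n k l _ _ hl hlk h m hm => elim_congr_last x y n hl.le hlk h hm,
    isClosedSystemSolution_a hd,
    fun x hx n k hk => hx.eq_of_forall_lt (isClosedSystemSolution_a hd) n k hk⟩
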